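/- Let $k$ be an algebraically closed field of characteristic $0$. Let $\mathcal{T}$ be a $k$-linear triangulated category of finite type, i.e. $\bigoplus_{i}\mathrm{Hom}(E,F[i])$ is finite dimensional over $k$ for all objects $E,F$. Write $\hom^i(E,F)=\dim_k \mathrm{Hom}(E,F[i])$. Suppose that $\mathcal{T}$ has a Serre functor $S$, i.e. an autoequivalence with isomorphisms $\mathrm{Hom}(X,Y)\cong \mathrm{Hom}(Y,SX)^{*}$ natural in $X$ and $Y$. Let $\mathrm{Stab}(\mathcal{T})$ be the set of locally finite Bridgeland stability conditions $\sigma=(Z,\mathcal{P}_\sigma)$ on $\mathcal{T}$, where $Z\colon K_0(\mathcal{T})\to\mathbb{C}$ is the central charge and $\mathcal{P}_\sigma$ the slicing. The global dimension of $\sigma$ is $$\mathrm{gldim}(\sigma)=\sup\{\varphi_2-\varphi_1 \mid \mathrm{Hom}(E_1,E_2)\neq 0 \text{ for some } E_1\in\mathcal{P}_\sigma(\varphi_1),\ E_2\in\mathcal{P}_\sigma(\varphi_2)\}.$$ Assume that $\mathcal{T}\neq 0$, and let $d$ be the minimum of $\hom^1(E,E)$ over all nonzero objects $E$ of $\mathcal{T}$.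 Assume that $d\geq 1$ and that $$\inf_{\sigma\in\mathrm{Stab}(\mathcal{T})}\mathrm{gldim}(\sigma)<\tfrac{6}{5}$$ (so that in particular $\mathrm{Stab}(\mathcal{T})\neq\emptyset$, the infimum of the empty set being $+\infty$). Then $d=1$, and every object $F$ of $\mathcal{T}$ with $\hom^1(F,F)=1$ is $1$-spherical, i.e. $SF\cong F[1]$, and $\mathrm{Hom}(F,F[i])$ is one-dimensional for $i=0,1$ and zero for all other $i\in\mathbb{Z}$. -/

import Mathlib

open CategoryTheory CategoryTheory.Limits CategoryTheory.Pretriangulated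

universe w v u

namespace StabCurve

noncomputable section

section Linear

variable (k : Type w) [Field k] {C : Type u} [Category.{v} C] [Preadditive C] [Linear k C]
  [HasShift C ℤ]

/-- `hom^i(E, F) = dim_k Hom(E, F[i])`. -/
def homDim (i : ℤ) (E F : C) : ℕ := Module.finrank k (E ⟶ F⟦i⟧)

variable (C) in
/-- `C` is of finite type over `k`: the total graded space `⨁_i Hom(E, F[i])` is finite
dimensional over `k`, for all objects `E`, `F`. -/
def IsFiniteType : Prop :=
  ∀ E F : C, Module.Finite k (DirectSum ℤ fun i => (E ⟶ F⟦i⟧))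

variable (C) in
/-- A Serre functor on a `k`-linear category: an autoequivalence `S` with isomorphisms
`Hom(X, Y) ≅ Hom(Y, S X)^*`, natural in `X` and in `Y`. (Linearity of `S` and compatibility with
the shift are automatic consequences.) -/
structure SerreFunctor where
  functor : C ⥤ C
  isEquivalence : functor.IsEquivalence
  duality (X Y : C) : (X ⟶ Y) ≃ₗ[k] Module.Dual k (Y ⟶ functor.obj X)
  naturality_right {X Y Y' : C} (f : X ⟶ Y) (g : Y ⟶ Y') (h : Y' ⟶ functor.obj X) :
    duality X Y' (f ≫ g) h = duality X Y f (g ≫ h)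
  naturality_left {X X' Y : C} (a : X' ⟶ X) (f : X ⟶ Y) (h : Y ⟶ functor.obj X') :
    duality X' Y (a ≫ f) h = duality X Y f (h ≫ functor.map a)

variable {k} in
/-- `E` is `1`-spherical: `S E ≅ E[1]`, and `Hom(E, E[i])` is `k` for `i = 0, 1` and zero
otherwise. -/
structure IsOneSpherical (S : SerreFunctor k C) (E : C) : Prop where
  serre : Nonempty (S.functor.obj E ≅ E⟦(1 : ℤ)⟧)
  hom_zero : homDim k 0 E E = 1
  hom_one : homDim k 1 E E = 1
  hom_other : ∀ i : ℤ, i ≠ 0 → i ≠ 1 → Subsingleton (E ⟶ E⟦i⟧)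

end Linear

section Stability

variable (C : Type u) [Category.{v} C] [Preadditive C] [HasZeroObject C] [HasShift C ℤ]
  [∀ n : ℤ, (shiftFunctor C n).Additive] [Pretriangulated C]

/-- The Grothendieck group `K_0(C)`: the free abelian group on the objects of `C` modulo the
relations `[Y] = [X] + [W]` for distinguished triangles `X ⟶ Y ⟶ W ⟶ X[1]`. -/
abbrev K0 : Type u :=
  FreeAbelianGroup C ⧸ AddSubgroup.closure
    {x : FreeAbelianGroup C | ∃ T ∈ distTriang C,
      x = FreeAbelianGroup.of T.obj₂ - (FreeAbelianGroup.of T.obj₁ + FreeAbelianGroup.of T.obj₃)}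

variable {C}

/-- The class of an object in `K_0(C)`. -/
def K0.of (E : C) : K0 C := QuotientAddGroup.mk (FreeAbelianGroup.of E)

/-- A Harder-Narasimhan filtration of `E` with respect to a family `P` of full subcategories
indexed by phases: a tower `0 = E_0 ⟶ E_1 ⟶ ⋯ ⟶ E_n = E` whose successive cones `A_i` lie
in `P(φ_i)`, for a strictly decreasing sequence of phases. -/
structure HNFiltration (P : ℝ → ObjectProperty C) (E : C) where
  n : ℕ
  phase : Fin n → ℝ
  phase_strictAnti : StrictAnti phase
  obj : Fin (n + 1) → C
  factor : Fin n → C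
  isZero_obj : IsZero (obj 0)
  isoLast : obj (Fin.last n) ≅ E
  ι (i : Fin n) : obj i.castSucc ⟶ obj i.succ
  π (i : Fin n) : obj i.succ ⟶ factor i
  δ (i : Fin n) : factor i ⟶ (obj i.castSucc)⟦(1 : ℤ)⟧
  distinguished (i : Fin n) : Triangle.mk (ι i) (π i) (δ i) ∈ distTriang C
  semistable (i : Fin n) : P (phase i) (factor i)

/-- `P(I)` for a set of phases `I`: the objects admitting a Harder-Narasimhan filtration all of
whose phases lie in `I` (this includes the zero objects). -/
def phaseIn (P : ℝ → ObjectProperty C) (I : Set ℝ) : ObjectProperty C :=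
  fun E => ∃ F : HNFiltration P E, ∀ i, F.phase i ∈ I

/-- A morphism `f : A ⟶ B` is a strict monomorphism of the subcategory `Q` if it completes to a
distinguished triangle all of whose vertices lie in `Q`. (For `Q = P(I)`, with `P` a slicing and
`I` an interval of length `< 1`, these are the strict monomorphisms of the quasi-abelian
category `P(I)`.) -/
def IsStrictMono (Q : ObjectProperty C) {A B : C} (f : A ⟶ B) : Prop :=
  Q A ∧ Q B ∧ ∃ (W : C) (g : B ⟶ W) (h : W ⟶ A⟦(1 : ℤ)⟧),
    Q W ∧ Triangle.mk f g h ∈ distTriang C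

/-- `Q` is of finite length: descending and ascending chains of strict subobjects of objects of
`Q` stabilise. -/
structure IsFiniteLength (Q : ObjectProperty C) : Prop where
  artinian : ∀ (X : ℕ → C) (i : ∀ n, X (n + 1) ⟶ X n), (∀ n, IsStrictMono Q (i n)) →
    ∃ N, ∀ n, N ≤ n → IsIso (i n)
  noetherian : ∀ (E : C) (X : ℕ → C) (i : ∀ n, X n ⟶ X (n + 1)) (j : ∀ n, X n ⟶ E),
    (∀ n, IsStrictMono Q (j n)) → (∀ n, i n ≫ j (n + 1) = j n) →
    ∃ N, ∀ n, N ≤ n → IsIso (i n)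

variable (C) in
/-- A (locally finite) Bridgeland stability condition on `C`: a central charge
`Z : K_0(C) → ℂ` together with a slicing `P`. -/
structure StabilityCondition where
  Z : K0 C →+ ℂ
  /-- the semistable objects of phase `φ`, together with the zero objects -/
  P : ℝ → ObjectProperty C
  closedUnderIso (φ : ℝ) : (P φ).IsClosedUnderIsomorphisms
  zero_mem (φ : ℝ) (X : C) : IsZero X → P φ X
  biprod_mem (φ : ℝ) (X Y : C) : P φ X → P φ Y → P φ (X ⊞ Y)
  charge (φ : ℝ) (E : C) : P φ E → ¬ IsZero E →
    ∃ m : ℝ, 0 < m ∧ Z (K0.of E) = m * Complex.exp (Complex.I * Real.pi * φ)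
  /-- `P(φ + 1) = P(φ)[1]` -/
  shift_iff (φ : ℝ) (E : C) : P (φ + 1) (E⟦(1 : ℤ)⟧) ↔ P φ E
  hom_eq_zero (φ₁ φ₂ : ℝ) (E₁ E₂ : C) : φ₂ < φ₁ → P φ₁ E₁ → P φ₂ E₂ → ∀ f : E₁ ⟶ E₂, f = 0
  exists_hn (E : C) : Nonempty (HNFiltration P E)
  locallyFinite : ∃ η : ℝ, 0 < η ∧ η < 1 / 2 ∧
    ∀ t : ℝ, IsFiniteLength (phaseIn P (Set.Ioo (t - η) (t + η)))

/-- The global dimension of a stability condition: the supremum of `φ₂ - φ₁` over all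
`E₁ ∈ P(φ₁)`, `E₂ ∈ P(φ₂)` with `Hom(E₁, E₂) ≠ 0`. It lies in `[0, +∞]` if `C ≠ 0`. -/
def gldim (σ : StabilityCondition C) : EReal :=
  sSup {x : EReal | ∃ (φ₁ φ₂ : ℝ) (E₁ E₂ : C) (f : E₁ ⟶ E₂),
    σ.P φ₁ E₁ ∧ σ.P φ₂ E₂ ∧ f ≠ 0 ∧ x = ((φ₂ - φ₁ : ℝ) : EReal)}

end Stability

end

end StabCurve

open StabCurve

/-! Fix `σ` with `gldim σ < 6/5`: a nonzero map between semistable objects raises the phase by less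
than `6/5` (`PhaseBound`). Hence Mukai's lemma (`mukai`) applies to Harder-Narasimhan triangles: if
`E` were unstable, two nonzero pieces would each contribute at least `d` to `hom^1(E,E)`. With an
Euler form count for repeated factors, every nonzero `E` with `hom^1(E,E) < 2d` is stable
(`exists_stable_of_homDim_lt`).

Let `X` be minimal, `hom^1(X,X) = d`, and `Y = SX[-1]`. Both are stable, of phases `φ` and `ψ`, and
`Hom(X,Y)` is dual to `Hom(X,X[1])`, so it has dimension `d > 0` and `φ ≤ ψ < φ + 1/5`. If `φ = ψ`,
a nonzero map `X ⟶ Y` is an isomorphism, so `SX ≅ X[1]`. Then `d = hom(X,SX) = hom(X,X) = 1`, and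
the remaining Hom spaces vanish by phases.

The case `φ < ψ` is excluded by `SerreShift.elim`. The cone `G` of any nonzero `f : X ⟶ Y` satisfies
`hom^1(G,G) < 2d`, so it is stable (`exists_stable_cone`); comparing Euler forms gives `hom^1(Y,X) ≤
2d - 2` (`finrank_le`). The pairing `(f₁,f₂) ↦ S(f₂) ∘ f₁[1]` goes from two `d`-dimensional spaces
to `Hom(X[1],SY)`, of dimension `hom^1(Y,X)`, so by Hopf's lemma (`exists_ne_zero_bilin_eq_zero`) it
vanishes on some nonzero `f₁`, `f₂`. This forces the cone of `f₁` to have phase below `φ + 2/5` and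
the cone of `f₂` to have phase above `φ + 4/5`, although both have the class `[Y] - [X]` and hence
the same central charge. -/

set_option linter.unusedSectionVars false

namespace StabCurve

/-! ### Hopf's lemma on bilinear maps, by growth of bigraded pieces. -/

section Hopf

open MvPolynomial

variable {k : Type*} [Field k] {m : ℕ}

/-- The bigrading of the polynomial ring in two sets of variables. -/
def biWeight (m : ℕ) : Fin (m + 1) ⊕ Fin (m + 1) → ℕ × ℕ :=
  Sum.elim (fun _ => (1, 0)) (fun _ => (0, 1))

lemma weight_biWeight (e : Fin (m + 1) ⊕ Fin (m + 1) →₀ ℕ) :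
    Finsupp.weight (biWeight m) e = (∑ i, e (Sum.inl i), ∑ j, e (Sum.inr j)) := by
  rw [Finsupp.weight_apply, Finsupp.sum_fintype _ _ (by simp)]
  simp [biWeight, Fintype.sum_sum_type, Prod.ext_iff, Prod.fst_sum, Prod.snd_sum]

/-- Polynomials of bidegree `(t, t)`. -/
abbrev biHom (k : Type*) [Field k] (m t : ℕ) :
    Submodule k (MvPolynomial (Fin (m + 1) ⊕ Fin (m + 1)) k) :=
  weightedHomogeneousSubmodule k (biWeight m) (t, t)

lemma biHom_le_of_radical {I : Ideal (MvPolynomial (Fin (m + 1) ⊕ Fin (m + 1)) k)}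
    (h : ∀ i j, X (Sum.inl i) * X (Sum.inr j) ∈ I.radical) :
    ∃ t₀, ∀ t, t₀ ≤ t → ∀ p ∈ biHom k m t, p ∈ I := by
  choose N hN using h
  obtain ⟨M, hM⟩ : ∃ M, ∀ i j, N i j ≤ M :=
    ⟨∑ i, ∑ j, N i j, fun i j =>
      (Finset.single_le_sum (f := fun j => N i j) (by simp) (Finset.mem_univ j)).trans
        (Finset.single_le_sum (f := fun i => ∑ j, N i j) (by simp) (Finset.mem_univ i))⟩
  -- Pigeonhole: if `m + 1` exponents sum to at least `(m + 1) * M`, one of them is at least `M`.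
  refine ⟨(m + 1) * M, fun t ht p hp => ?_⟩
  have key : ∀ f : Fin (m + 1) → ℕ, ∑ i, f i = t → ∃ i, M ≤ f i := by
    intro f hf
    by_contra! hcon
    have := Finset.sum_lt_sum_of_nonempty (s := Finset.univ) Finset.univ_nonempty
      (fun i _ => hcon i)
    simp at this
    omega
  refine IsWeightedHomogeneous.induction_on (motive := fun p _ => p ∈ I) I.zero_mem
    (fun p q _ _ hp hq => I.add_mem hp hq) (fun e r he => ?_) hp
  rw [weight_biWeight, Prod.mk.injEq] at he
  obtain ⟨i, hi⟩ := key _ he.1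
  obtain ⟨j, hj⟩ := key _ he.2
  have h1 : (X (Sum.inl i) * X (Sum.inr j)) ^ M ∈ I := I.pow_mem_of_pow_mem (hN i j) (hM i j)
  have h2 : (X (Sum.inl i) * X (Sum.inr j)) ^ M ∣ monomial e r := by
    have : (X (Sum.inl i) * X (Sum.inr j)) ^ M =
        monomial (Finsupp.single (Sum.inl i) M + Finsupp.single (Sum.inr j) M) (1 : k) := by
      rw [mul_pow, X_pow_eq_monomial, X_pow_eq_monomial, monomial_mul, one_mul]
    rw [this, monomial_dvd_monomial]
    refine ⟨Or.inr fun x => ?_, one_dvd _⟩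
    rcases x with x | x
    · by_cases hx : i = x
      · subst hx; simpa using hi
      · simp [hx]
    · by_cases hx : j = x
      · subst hx; simpa using hj
      · simp [hx]
  exact I.mem_of_dvd h2 h1

attribute [local instance] MvPolynomial.weightedGradedAlgebra in
lemma exists_biHom_combination {n : ℕ} (b : Fin n → MvPolynomial (Fin (m + 1) ⊕ Fin (m + 1)) k)
    (hb : ∀ l, b l ∈ biHom k m 1) {t : ℕ} {p : MvPolynomial (Fin (m + 1) ⊕ Fin (m + 1)) k}
    (hp : p ∈ biHom k m (t + 1)) (hI : p ∈ Ideal.span (Set.range b)) :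
    ∃ q : Fin n → MvPolynomial (Fin (m + 1) ⊕ Fin (m + 1)) k, (∀ l, q l ∈ biHom k m t) ∧
      p = ∑ l, b l * q l := by
  obtain ⟨c, hc⟩ := Ideal.mem_span_range_iff_exists_fun.1 hI
  let 𝒜 := weightedHomogeneousSubmodule k (biWeight m)
  -- As `b l` has bidegree `(1, 1)`, only the `(t, t)` component of each coefficient contributes in
  -- bidegree `(t + 1, t + 1)`.
  refine ⟨fun l => (DirectSum.decompose 𝒜 (c l) (t, t) :), fun l => SetLike.coe_mem _, ?_⟩
  have h1 : (DirectSum.decompose 𝒜 p (t + 1, t + 1) :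
      MvPolynomial (Fin (m + 1) ⊕ Fin (m + 1)) k) = p := DirectSum.decompose_of_mem_same 𝒜 hp
  rw [← hc, DirectSum.decompose_sum, DFinsupp.finsetSum_apply, AddSubmonoidClass.coe_finsetSum,
    hc] at h1
  rw [← h1]
  refine Finset.sum_congr rfl fun l _ => ?_
  have := DirectSum.coe_decompose_mul_add_of_right_mem 𝒜 (i := (t, t)) (a := c l) (hb l)
  rw [mul_comm (b l), ← this]
  rfl

/-- Once the ideal contains all high bidegrees, factors `b l` can be split off repeatedly until
bidegree `(t₀, t₀)` is reached. Thus the dimension in bidegree `(t₀ + s, t₀ + s)` is bounded by a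
constant times the number of monomials of degree `s` in the `b l`. -/
lemma biHom_le_span {n : ℕ} (b : Fin n → MvPolynomial (Fin (m + 1) ⊕ Fin (m + 1)) k)
    (hb : ∀ l, b l ∈ biHom k m 1) {t₀ : ℕ}
    (hI : ∀ t, t₀ ≤ t → ∀ p ∈ biHom k m t, p ∈ Ideal.span (Set.range b)) (s : ℕ) :
    ∀ p ∈ biHom k m (t₀ + s), p ∈ Submodule.span k
      (Set.image2 (fun (α : Fin n → ℕ) q => (∏ l, b l ^ α l) * q) {α | ∑ l, α l = s}
        (biHom k m t₀)) := by
  induction s with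
  | zero =>
    intro p hp
    exact Submodule.subset_span ⟨0, by simp, p, hp, by simp⟩
  | succ s ih =>
    intro p hp
    obtain ⟨q, hq, rfl⟩ := exists_biHom_combination b hb (t := t₀ + s) hp
      (hI _ (by omega) _ hp)
    refine Submodule.sum_mem _ fun l _ => ?_
    have := ih _ (hq l)
    have h2 := Submodule.mem_map_of_mem (f := LinearMap.mulLeft k (b l)) this
    rw [Submodule.map_span] at h2
    refine Submodule.span_mono ?_ h2
    rintro _ ⟨_, ⟨α, hα, r, hr, rfl⟩, rfl⟩
    refine ⟨α + Pi.single l 1, ?_, r, hr, ?_⟩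
    · simp only [Set.mem_ofPred_eq] at hα
      simp [Finset.sum_add_distrib, hα]
    · simp only [Pi.add_apply, pow_add, Finset.prod_mul_distrib, LinearMap.mulLeft_apply]
      rw [Finset.prod_eq_single (f := fun x => b x ^ (Pi.single l 1 : Fin n → ℕ) x) l]
      · simp; ring
      · intro x _ hx; simp [hx]
      · simp

lemma biHom_fg (t : ℕ) : ∃ S : Finset (MvPolynomial (Fin (m + 1) ⊕ Fin (m + 1)) k),
    biHom k m t ≤ Submodule.span k S := by
  classical
  refine ⟨(Finset.Iic (Finsupp.equivFunOnFinite.symm fun _ => t)).image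
    fun e => monomial e (1 : k), fun p hp => ?_⟩
  refine IsWeightedHomogeneous.induction_on
    (motive := fun p _ => p ∈ Submodule.span k _) (Submodule.zero_mem _)
    (fun p q _ _ hp hq => Submodule.add_mem _ hp hq) (fun e r he => ?_) hp
  rw [weight_biWeight, Prod.mk.injEq] at he
  have : monomial e r = r • monomial e (1 : k) := by simp [smul_monomial]
  rw [this]
  refine Submodule.smul_mem _ _ (Submodule.subset_span ?_)
  simp only [Finset.coe_image, Set.mem_image, Finset.mem_coe, Finset.mem_Iic]
  refine ⟨e, fun x => ?_, rfl⟩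
  rcases x with x | x
  · simpa [← he.1] using Finset.single_le_sum (f := fun i => e (Sum.inl i)) (by simp)
      (Finset.mem_univ x)
  · simpa [← he.2] using Finset.single_le_sum (f := fun i => e (Sum.inr i)) (by simp)
      (Finset.mem_univ x)

lemma card_exponents_le (n s : ℕ) :
    ∃ A : Finset (Fin (n + 1) → ℕ), {α : Fin (n + 1) → ℕ | ∑ l, α l = s} ⊆ A ∧
      A.card ≤ (s + 1) ^ n := by
  classical
  refine ⟨(Fintype.piFinset fun _ : Fin n => Finset.range (s + 1)).image
    fun β => (Fin.cons (s - ∑ i, β i) β : Fin (n + 1) → ℕ), fun α hα => ?_, ?_⟩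
  · simp only [Set.mem_ofPred_eq] at hα
    rw [Fin.sum_univ_succ] at hα
    simp only [Finset.coe_image, Set.mem_image, Finset.mem_coe, Fintype.mem_piFinset,
      Finset.mem_range]
    refine ⟨fun i => α i.succ, fun i => ?_, ?_⟩
    · have := Finset.single_le_sum (f := fun i : Fin n => α i.succ) (by simp) (Finset.mem_univ i)
      change α i.succ < s + 1
      change α i.succ ≤ ∑ i : Fin n, α i.succ at this
      omega
    · refine funext fun i => ?_
      refine Fin.cases ?_ (fun i => ?_) i
      · change s - ∑ i : Fin n, α i.succ = α 0
        omega
      · rfl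
  · refine Finset.card_image_le.trans ?_
    simp

/-- The monomial exponents `(t - Σ a, a_1, ..., a_m; t - Σ b, b_1, ..., b_m)`. -/
noncomputable def boxExponent (m t : ℕ) (a b : Fin m → ℕ) : Fin (m + 1) ⊕ Fin (m + 1) →₀ ℕ :=
  Finsupp.equivFunOnFinite.symm (Sum.elim (Fin.cons (t - ∑ i, a i) a) (Fin.cons (t - ∑ i, b i) b))

/-- Bidegree `(t, t)` with `t = m * q` leaves `2 * m` exponents free in `[0, q)`; the two exponents
of index `0` absorb the rest. So the growth has order at least `2 * m`. -/
lemma pow_le_of_biHom_le_span {q : ℕ} {S : Finset (MvPolynomial (Fin (m + 1) ⊕ Fin (m + 1)) k)}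
    (hS : biHom k m (m * q) ≤ Submodule.span k S) : q ^ m * q ^ m ≤ S.card := by
  classical
  let f : (Fin m → Fin q) × (Fin m → Fin q) → MvPolynomial (Fin (m + 1) ⊕ Fin (m + 1)) k :=
    fun x => monomial (boxExponent m (m * q) (fun i => x.1 i) (fun i => x.2 i)) 1
  have hsum : ∀ a : Fin m → Fin q, ∑ i, (a i : ℕ) ≤ m * q := fun a => by
    simpa using Finset.sum_le_card_nsmul Finset.univ (fun i => (a i : ℕ)) q
      (fun i _ => (a i).2.le)
  have hf : ∀ x, f x ∈ Submodule.span k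
      (S : Set (MvPolynomial (Fin (m + 1) ⊕ Fin (m + 1)) k)) := by
    intro x
    refine hS (isWeightedHomogeneous_monomial _ _ _ ?_)
    have h1 := hsum x.1
    have h2 := hsum x.2
    rw [weight_biWeight, Prod.mk.injEq]
    constructor <;> simp [boxExponent, Fin.sum_univ_succ] <;> omega
  have hinj : Function.Injective fun x : (Fin m → Fin q) × (Fin m → Fin q) =>
      boxExponent m (m * q) (fun i => x.1 i) (fun i => x.2 i) := by
    intro x y hxy
    refine Prod.ext (funext fun i => ?_) (funext fun i => ?_)
    · simpa [boxExponent, Fin.ext_iff] using DFunLike.congr_fun hxy (Sum.inl i.succ)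
    · simpa [boxExponent, Fin.ext_iff] using DFunLike.congr_fun hxy (Sum.inr i.succ)
  have hli : LinearIndependent k f :=
    ((basisMonomials (Fin (m + 1) ⊕ Fin (m + 1)) k).linearIndependent.comp _ hinj :)
  have hli' : LinearIndependent k fun x => (⟨f x, hf x⟩ : Submodule.span k
      (S : Set (MvPolynomial (Fin (m + 1) ⊕ Fin (m + 1)) k))) :=
    LinearIndependent.of_comp (Submodule.subtype _) hli
  have h := hli'.fintype_card_le_finrank.trans (finrank_span_finset_le_card S)
  rwa [Fintype.card_prod, Fintype.card_fun, Fintype.card_fin, Fintype.card_fin] at h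

/-- Hopf's lemma: a bilinear map `V × V' → W` over an algebraically closed field without zero
divisors has `dim W ≥ dim V + dim V' - 1`; here in coordinates, for `dim V = dim V' = m + 1`. -/
lemma exists_common_zero [IsAlgClosed k] {n : ℕ} (hn : n + 1 ≤ 2 * m)
    (c : Fin (n + 1) → Fin (m + 1) → Fin (m + 1) → k) :
    ∃ x y : Fin (m + 1) → k, x ≠ 0 ∧ y ≠ 0 ∧ ∀ l, ∑ i, ∑ j, c l i j * (x i * y j) = 0 := by
  classical
  by_contra! hcon
  let b : Fin (n + 1) → MvPolynomial (Fin (m + 1) ⊕ Fin (m + 1)) k :=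
    fun l => ∑ i, ∑ j, C (c l i j) * (X (Sum.inl i) * X (Sum.inr j))
  have hb : ∀ l, b l ∈ biHom k m 1 := fun l => by
    refine Submodule.sum_mem _ fun i _ => Submodule.sum_mem _ fun j _ => ?_
    refine IsWeightedHomogeneous.C_mul ?_ _
    exact (isWeightedHomogeneous_X k (biWeight m) (Sum.inl i)).mul
      (isWeightedHomogeneous_X k (biWeight m) (Sum.inr j))
  -- By `hcon`, at a common zero of the `b l` one of the two vectors is zero, so every product `x_i
  -- y_j` vanishes there; the Nullstellensatz applies.
  have hrad : ∀ i j, X (Sum.inl i) * X (Sum.inr j) ∈ (Ideal.span (Set.range b)).radical := by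
    intro i j
    rw [← vanishingIdeal_zeroLocus_eq_radical (K := k)]
    intro z hz
    rw [zeroLocus_span] at hz
    by_contra hne
    simp only [map_mul, aeval_X, mul_eq_zero, not_or] at hne
    obtain ⟨l, hl⟩ := hcon (fun i => z (Sum.inl i)) (fun j => z (Sum.inr j))
      (fun h => hne.1 (congrFun h i)) (fun h => hne.2 (congrFun h j))
    apply hl
    simpa [b] using hz _ ⟨l, rfl⟩
  obtain ⟨t₀, ht₀⟩ := biHom_le_of_radical hrad
  obtain ⟨S, hS⟩ := biHom_fg (k := k) (m := m) t₀
  have hbound : ∀ s, ∃ T : Finset (MvPolynomial (Fin (m + 1) ⊕ Fin (m + 1)) k),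
      biHom k m (t₀ + s) ≤ Submodule.span k T ∧ T.card ≤ (s + 1) ^ n * S.card := by
    intro s
    obtain ⟨A, hA, hAc⟩ := card_exponents_le n s
    refine ⟨Finset.image₂ (fun α q => (∏ l, b l ^ α l) * q) A S, fun p hp => ?_,
      (Finset.card_image₂_le _ _ _).trans (Nat.mul_le_mul_right _ hAc)⟩
    refine Submodule.span_le.2 ?_ (biHom_le_span b hb ht₀ s p hp)
    rintro _ ⟨α, hα, q, hq, rfl⟩
    have h2 := Submodule.mem_map_of_mem (f := LinearMap.mulLeft k (∏ l, b l ^ α l)) (hS hq)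
    rw [Submodule.map_span] at h2
    refine Submodule.span_mono ?_ h2
    rintro _ ⟨r, hr, rfl⟩
    exact Finset.mem_coe.2 (Finset.mem_image₂.2 ⟨α, hA hα, r, hr, rfl⟩)
  have hm : 1 ≤ m := by omega
  -- The two bounds combine to `q ^ (n + 1) ≤ q ^ (2 * m) ≤ ((m + 1) * q) ^ n * S.card`, that is, `q
  -- ≤ (m + 1) ^ n * S.card`. This `q` is too large for that, and also makes `m * q ≥ t₀`.
  set q := t₀ + (m + 1) ^ n * S.card + 1 with hq
  have hq1 : t₀ ≤ m * q := by nlinarith [Nat.zero_le ((m + 1) ^ n * S.card)]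
  obtain ⟨T, hT, hTc⟩ := hbound (m * q - t₀)
  rw [Nat.add_sub_cancel' hq1] at hT
  have h1 := (pow_le_of_biHom_le_span hT).trans hTc
  have h2 : m * q - t₀ + 1 ≤ (m + 1) * q := by
    have : 1 ≤ q := by omega
    rw [add_mul]; omega
  have h3 : q ^ (n + 1) ≤ q ^ m * q ^ m := by
    rw [← pow_add]
    exact Nat.pow_le_pow_right (by omega) (by omega)
  have h4 : q ^ n * q ≤ q ^ n * ((m + 1) ^ n * S.card) := by
    calc q ^ n * q = q ^ (n + 1) := (pow_succ _ _).symm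
      _ ≤ _ := h3.trans h1
      _ ≤ ((m + 1) * q) ^ n * S.card := Nat.mul_le_mul_right _ (Nat.pow_le_pow_left h2 _)
      _ = _ := by rw [mul_pow]; ring
  have h5 := Nat.le_of_mul_le_mul_left h4 (by positivity)
  omega

/-- Hopf's lemma: a bilinear map `V × V' → W` over an algebraically closed field with
`dim V = dim V' > 0` and `dim W < dim V + dim V' - 1` has a zero divisor. -/
theorem exists_ne_zero_bilin_eq_zero [IsAlgClosed k] {V V' W : Type*} [AddCommGroup V]
    [Module k V] [AddCommGroup V'] [Module k V'] [AddCommGroup W] [Module k W]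
    [FiniteDimensional k W]
    (B : V →ₗ[k] V' →ₗ[k] W) (hV : Module.finrank k V = m + 1) (hV' : Module.finrank k V' = m + 1)
    (hW : Module.finrank k W ≤ 2 * m) : ∃ x y, x ≠ 0 ∧ y ≠ 0 ∧ B x y = 0 := by
  have : FiniteDimensional k V := FiniteDimensional.of_finrank_pos (by omega)
  have : FiniteDimensional k V' := FiniteDimensional.of_finrank_pos (by omega)
  let e := (Module.finBasisOfFinrankEq k V hV)
  let e' := (Module.finBasisOfFinrankEq k V' hV')
  rcases h : Module.finrank k W with _ | n
  · have : Subsingleton W := Module.finrank_zero_iff.1 h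
    exact ⟨e 0, e' 0, e.ne_zero _, e'.ne_zero _, Subsingleton.elim _ _⟩
  · let g := (Module.finBasisOfFinrankEq k W h)
    obtain ⟨x, y, hx, hy, hxy⟩ := exists_common_zero (n := n) (by omega)
      fun l i j => g.repr (B (e i) (e' j)) l
    refine ⟨e.equivFun.symm x, e'.equivFun.symm y,
      (LinearEquiv.map_ne_zero_iff _).2 hx, (LinearEquiv.map_ne_zero_iff _).2 hy, ?_⟩
    apply g.repr.injective
    ext l
    rw [map_zero, Finsupp.zero_apply, ← hxy l]
    simp only [Module.Basis.equivFun_symm_apply, map_sum, map_smul, LinearMap.sum_apply,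
      LinearMap.smul_apply, Finsupp.finsetSum_apply, Finsupp.smul_apply, smul_eq_mul,
      Finset.mul_sum]
    rw [Finset.sum_comm]
    refine Finset.sum_congr rfl fun i _ => Finset.sum_congr rfl fun j _ => by ring

end Hopf

/-! ### Ranks in exact sequences. -/

section LinearAlgebra

/-- Telescoping of Euler characteristics along a long exact sequence. -/
lemma finsum_alternating_of_exact {x y z r s t : ℤ → ℕ} (hy : ∀ i, y i = r i + s i)
    (hz : ∀ i, z i = s i + t i) (hx : ∀ i, x (i + 1) = t i + r (i + 1))
    (hx' : {i | x i ≠ 0}.Finite) (hz' : {i | z i ≠ 0}.Finite) (hy' : {i | y i ≠ 0}.Finite) :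
    ∑ᶠ i : ℤ, (i.negOnePow : ℤ) * y i =
      ∑ᶠ i : ℤ, (i.negOnePow : ℤ) * x i + ∑ᶠ i : ℤ, (i.negOnePow : ℤ) * z i := by
  have supp : ∀ q : ℤ → ℕ, {i | q i ≠ 0}.Finite →
      (Function.support fun i : ℤ => (i.negOnePow : ℤ) * (q i : ℤ)).Finite := fun q hq =>
    hq.subset fun i hi => by
      simp only [Function.mem_support, ne_eq, mul_eq_zero, not_or] at hi
      simpa using hi.2
  have ht : {i | t i ≠ 0}.Finite := hz'.subset fun i hi => by
    have := hz i
    simp only [Set.mem_ofPred_eq] at hi ⊢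
    omega
  have ht1 : {i | t (i - 1) ≠ 0}.Finite := hx'.subset fun i hi => by
    have := hx (i - 1)
    simp only [Set.mem_ofPred_eq, sub_add_cancel] at hi this ⊢
    omega
  have h1 : ∑ᶠ i : ℤ, (i.negOnePow : ℤ) * (t (i - 1) : ℕ) =
      - ∑ᶠ i : ℤ, (i.negOnePow : ℤ) * (t i : ℕ) := by
    rw [← finsum_neg_distrib, ← finsum_comp_equiv (Equiv.subRight (1 : ℤ))
      (f := fun i : ℤ => -((i.negOnePow : ℤ) * (t i : ℕ)))]
    refine finsum_congr fun i => ?_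
    simp [Int.negOnePow_sub]
  have h2 : ∑ᶠ i : ℤ, ((i.negOnePow : ℤ) * y i + ((i.negOnePow : ℤ) * t i +
      (i.negOnePow : ℤ) * (t (i - 1) : ℕ))) =
      ∑ᶠ i : ℤ, ((i.negOnePow : ℤ) * x i + (i.negOnePow : ℤ) * z i) := by
    refine finsum_congr fun i => ?_
    have a := hy i
    have b := hz i
    have c := hx (i - 1)
    rw [sub_add_cancel] at c
    rw [a, b, c]
    push_cast
    ring
  rw [finsum_add_distrib (supp _ hy') (((supp _ ht).union (supp _ ht1)).subset
      (Function.support_add _ _)), finsum_add_distrib (supp _ ht) (supp _ ht1), h1,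
    finsum_add_distrib (supp _ hx') (supp _ hz')] at h2
  linarith

variable {k U V W : Type*} [Field k] [AddCommGroup U] [Module k U] [AddCommGroup V] [Module k V]
  [AddCommGroup W] [Module k W]

lemma finrank_eq_rank_add_rank [FiniteDimensional k V] (a : U →ₗ[k] V) (b : V →ₗ[k] W)
    (hab : ∀ u, b (a u) = 0) (hex : ∀ v, b v = 0 → ∃ u, a u = v) :
    Module.finrank k V = Module.finrank k a.range + Module.finrank k b.range := by
  have : a.range = b.ker := le_antisymm (by rintro _ ⟨u, rfl⟩; exact hab u)
    fun v hv => hex v hv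
  rw [this, add_comm, LinearMap.finrank_range_add_finrank_ker]

lemma finrank_range_eq_of_comm {U' V' : Type*} [AddCommGroup U'] [Module k U'] [AddCommGroup V']
    [Module k V'] (a : U →ₗ[k] V) (a' : U' →ₗ[k] V') (e : U ≃ₗ[k] U') (e' : V ≃ₗ[k] V')
    (h : ∀ u, e' (a u) = a' (e u)) : Module.finrank k a.range = Module.finrank k a'.range := by
  have : a'.range = a.range.map (e' : V →ₗ[k] V') := by
    ext v
    constructor
    · rintro ⟨u, rfl⟩
      exact ⟨_, ⟨e.symm u, rfl⟩, by simp [h]⟩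
    · rintro ⟨_, ⟨u, rfl⟩, rfl⟩
      exact ⟨e u, (h u).symm⟩
  rw [this, LinearEquiv.finrank_map_eq]

end LinearAlgebra

/-! ### Lifting and extension along distinguished triangles. -/

section Triangles

variable {C : Type u} [Category.{v} C] [Preadditive C] [HasZeroObject C] [HasShift C ℤ]
  [∀ n : ℤ, (shiftFunctor C n).Additive] [Pretriangulated C]
  {X Y W : C} {f : X ⟶ Y} {g : Y ⟶ W} {h : W ⟶ X⟦(1 : ℤ)⟧}

/-- The isomorphism `X⟦0⟧ ≅ X`. -/
noncomputable def shiftZeroIso (X : C) : X⟦(0 : ℤ)⟧ ≅ X := (shiftFunctorZero C ℤ).app X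

/-- The isomorphism `X⟦c⟧ ≅ X⟦a⟧⟦b⟧` for `a + b = c`. -/
noncomputable def shiftIso (X : C) (a b c : ℤ) (h : a + b = c) : X⟦c⟧ ≅ X⟦a⟧⟦b⟧ :=
  (shiftFunctorAdd' C a b c h).app X

lemma exact₁₂ (hT : Triangle.mk f g h ∈ distTriang C) : f ≫ g = 0 :=
  comp_distTriang_mor_zero₁₂ _ hT

lemma exact₂₃ (hT : Triangle.mk f g h ∈ distTriang C) : g ≫ h = 0 :=
  comp_distTriang_mor_zero₂₃ _ hT

lemma exact₃₁ (hT : Triangle.mk f g h ∈ distTriang C) : h ≫ f⟦(1 : ℤ)⟧' = 0 :=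
  comp_distTriang_mor_zero₃₁ _ hT

lemma lift₁ (hT : Triangle.mk f g h ∈ distTriang C) {Z : C} (u : Z ⟶ Y) (hu : u ≫ g = 0) :
    ∃ v : Z ⟶ X, u = v ≫ f :=
  Triangle.coyoneda_exact₂ _ hT u hu

lemma lift₂ (hT : Triangle.mk f g h ∈ distTriang C) {Z : C} (u : Z ⟶ W) (hu : u ≫ h = 0) :
    ∃ v : Z ⟶ Y, u = v ≫ g :=
  Triangle.coyoneda_exact₃ _ hT u hu

lemma lift₃ (hT : Triangle.mk f g h ∈ distTriang C) {Z : C} (u : Z ⟶ X⟦(1 : ℤ)⟧)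
    (hu : u ≫ f⟦(1 : ℤ)⟧' = 0) : ∃ v : Z ⟶ W, u = v ≫ h :=
  Triangle.coyoneda_exact₁ _ hT u hu

lemma desc₂ (hT : Triangle.mk f g h ∈ distTriang C) {Z : C} (u : Y ⟶ Z) (hu : f ≫ u = 0) :
    ∃ v : W ⟶ Z, u = g ≫ v :=
  Triangle.yoneda_exact₂ _ hT u hu

lemma desc₃ (hT : Triangle.mk f g h ∈ distTriang C) {Z : C} (u : W ⟶ Z) (hu : g ≫ u = 0) :
    ∃ v : X⟦(1 : ℤ)⟧ ⟶ Z, u = h ≫ v :=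
  Triangle.yoneda_exact₃ _ hT u hu

lemma rotate_mem (hT : Triangle.mk f g h ∈ distTriang C) :
    Triangle.mk g h (-f⟦(1 : ℤ)⟧') ∈ distTriang C :=
  rot_of_distTriang _ hT

lemma desc₁ (hT : Triangle.mk f g h ∈ distTriang C) {Z : C} (u : X⟦(1 : ℤ)⟧ ⟶ Z)
    (hu : h ≫ u = 0) : ∃ v : Y⟦(1 : ℤ)⟧ ⟶ Z, u = f⟦(1 : ℤ)⟧' ≫ v := by
  obtain ⟨v, hv⟩ := desc₃ (rotate_mem hT) u hu
  exact ⟨-v, by rw [hv, Preadditive.neg_comp, Preadditive.comp_neg]⟩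

/-- Lifting along the once shifted first map. -/
lemma lift_shift₁ (hT : Triangle.mk f g h ∈ distTriang C) {Z : C} (u : Z ⟶ Y⟦(1 : ℤ)⟧)
    (hu : u ≫ g⟦(1 : ℤ)⟧' = 0) : ∃ v : Z ⟶ X⟦(1 : ℤ)⟧, u = v ≫ f⟦(1 : ℤ)⟧' := by
  obtain ⟨v, hv⟩ := lift₃ (rotate_mem hT) u hu
  exact ⟨-v, by rw [hv, Preadditive.neg_comp, Preadditive.comp_neg]⟩

lemma lift_shift₂ (hT : Triangle.mk f g h ∈ distTriang C) {Z : C} (u : Z ⟶ W⟦(1 : ℤ)⟧)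
    (hu : u ≫ h⟦(1 : ℤ)⟧' = 0) : ∃ v : Z ⟶ Y⟦(1 : ℤ)⟧, u = v ≫ g⟦(1 : ℤ)⟧' :=
  lift_shift₁ (rotate_mem hT) u hu

lemma desc_shift₂ (hT : Triangle.mk f g h ∈ distTriang C) {Z : C} (u : Y⟦(1 : ℤ)⟧ ⟶ Z)
    (hu : f⟦(1 : ℤ)⟧' ≫ u = 0) : ∃ v : W⟦(1 : ℤ)⟧ ⟶ Z, u = g⟦(1 : ℤ)⟧' ≫ v :=
  desc₁ (rotate_mem hT) u (by rw [Preadditive.neg_comp, hu, neg_zero])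

end Triangles

/-! ### Dimensions of Hom spaces, the Euler form and Mukai's lemma. -/

section HomDim

variable (k : Type w) [Field k] {C : Type u} [Category.{v} C] [Preadditive C] [Linear k C]
  [HasZeroObject C] [HasShift C ℤ]
  [∀ n : ℤ, (shiftFunctor C n).Additive] [∀ n : ℤ, (shiftFunctor C n).Linear k]
  [Pretriangulated C]

/-- The linear isomorphism `Hom(X, Y) ≃ Hom(X[n], Y[n])`. -/
noncomputable def shiftHomEquiv (n : ℤ) (X Y : C) : (X ⟶ Y) ≃ₗ[k] (X⟦n⟧ ⟶ Y⟦n⟧) :=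
  LinearEquiv.ofBijective ((shiftFunctor C n).mapLinearMap k)
    ⟨(shiftFunctor C n).map_injective, (shiftFunctor C n).map_surjective⟩

lemma shiftHomEquiv_apply (n : ℤ) {X Y : C} (f : X ⟶ Y) : shiftHomEquiv k n X Y f = f⟦n⟧' := rfl

lemma finrank_hom_congr {X X' Y Y' : C} (e : X ≅ X') (e' : Y ≅ Y') :
    Module.finrank k (X ⟶ Y) = Module.finrank k (X' ⟶ Y') :=
  (Linear.homCongr k e e').finrank_eq

lemma homDim_congr {X X' Y Y' : C} (e : X ≅ X') (e' : Y ≅ Y') (i : ℤ) :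
    homDim k i X Y = homDim k i X' Y' :=
  finrank_hom_congr k e ((shiftFunctor C i).mapIso e')

lemma finrank_hom_shift_shift (X Y : C) (a b i : ℤ) (h : a + i = b) :
    Module.finrank k (X⟦a⟧ ⟶ Y⟦b⟧) = homDim k i X Y := by
  rw [finrank_hom_congr k (Iso.refl _) (shiftIso Y i a b (by omega))]
  exact (shiftHomEquiv k a X (Y⟦i⟧)).finrank_eq.symm

lemma homDim_zero (X Y : C) : homDim k 0 X Y = Module.finrank k (X ⟶ Y) :=
  finrank_hom_congr k (Iso.refl _) (shiftZeroIso Y)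

lemma homDim_shift_shift (X Y : C) (a b i j : ℤ) (h : a + i = b + j) :
    homDim k j (X⟦a⟧) (Y⟦b⟧) = homDim k i X Y := by
  rw [homDim, finrank_hom_congr k (Iso.refl _) (shiftIso Y b j (b + j) rfl).symm]
  exact finrank_hom_shift_shift k X Y _ _ _ h

/-- The Euler form. -/
noncomputable def eulerForm (X Y : C) : ℤ := ∑ᶠ i : ℤ, (i.negOnePow : ℤ) * homDim k i X Y

lemma eulerForm_eq {X Y : C} (h : ∀ i : ℤ, i ≠ 0 → i ≠ 1 → homDim k i X Y = 0) :
    eulerForm k X Y = homDim k 0 X Y - homDim k 1 X Y := by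
  rw [eulerForm, finsum_eq_sum_of_support_subset (s := {0, 1})]
  · simp [sub_eq_add_neg]
  · intro i hi
    by_contra hcon
    simp only [Finset.coe_insert, Finset.coe_singleton, Set.mem_insert_iff,
      Set.mem_singleton_iff, not_or] at hcon
    simp [h i hcon.1 hcon.2] at hi

variable {k}

section

variable {X Y W : C} {f : X ⟶ Y} {g : Y ⟶ W} {h : W ⟶ X⟦(1 : ℤ)⟧}

lemma finrank_range_rightComp_shift (V V' : C) (f : X ⟶ Y) (e : V ≅ V'⟦(1 : ℤ)⟧) :
    Module.finrank k (Linear.rightComp k V (f⟦(1 : ℤ)⟧')).range =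
      Module.finrank k (Linear.rightComp k V' f).range := by
  symm
  refine finrank_range_eq_of_comm _ _
    ((shiftHomEquiv k 1 _ _).trans (Linear.homCongr k e.symm (Iso.refl _)))
    ((shiftHomEquiv k 1 _ _).trans (Linear.homCongr k e.symm (Iso.refl _))) fun u => ?_
  simp [shiftHomEquiv_apply, Linear.homCongr_apply]

lemma finrank_range_leftComp_shift (V V' : C) (f : X ⟶ Y) (e : V ≅ V'⟦(1 : ℤ)⟧) :
    Module.finrank k (Linear.leftComp k V (f⟦(1 : ℤ)⟧')).range =
      Module.finrank k (Linear.leftComp k V' f).range := by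
  symm
  refine finrank_range_eq_of_comm _ _
    ((shiftHomEquiv k 1 _ _).trans (Linear.homCongr k (Iso.refl _) e.symm))
    ((shiftHomEquiv k 1 _ _).trans (Linear.homCongr k (Iso.refl _) e.symm)) fun u => ?_
  simp [shiftHomEquiv_apply, Linear.homCongr_apply]

variable [∀ X Y : C, FiniteDimensional k (X ⟶ Y)]

lemma eulerForm_additive_right (hfin : ∀ X Y : C, {i | homDim k i X Y ≠ 0}.Finite)
    (hT : Triangle.mk f g h ∈ distTriang C) (Z : C) :
    eulerForm k Z Y = eulerForm k Z X + eulerForm k Z W := by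
  -- Moving the shift to the source lets the unshifted maps `f`, `g`, `h` serve in every degree.
  have hd : ∀ (V : C) (i : ℤ), homDim k i Z V = Module.finrank k (Z⟦-i⟧ ⟶ V) := fun V i => by
    rw [finrank_hom_congr k (Iso.refl _) (shiftZeroIso V).symm]
    exact (finrank_hom_shift_shift k Z V (-i) 0 i (by omega)).symm
  refine finsum_alternating_of_exact
    (r := fun i => Module.finrank k (Linear.rightComp k (Z⟦-i⟧) f).range)
    (s := fun i => Module.finrank k (Linear.rightComp k (Z⟦-i⟧) g).range)
    (t := fun i => Module.finrank k (Linear.rightComp k (Z⟦-i⟧) h).range)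
    (fun i => ?_) (fun i => ?_) (fun i => ?_) (hfin _ _) (hfin _ _) (hfin _ _)
  · rw [hd]
    refine finrank_eq_rank_add_rank _ _ (fun u => by simp [exact₁₂ hT]) fun u hu => ?_
    obtain ⟨v, hv⟩ := lift₁ hT u hu
    exact ⟨v, hv.symm⟩
  · rw [hd]
    refine finrank_eq_rank_add_rank _ _ (fun u => by simp [exact₂₃ hT]) fun u hu => ?_
    obtain ⟨v, hv⟩ := lift₂ hT u hu
    exact ⟨v, hv.symm⟩
  · rw [← finrank_range_rightComp_shift (k := k) (Z⟦-i⟧) (Z⟦-(i + 1)⟧) f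
      (shiftIso Z _ _ _ (by omega)), ← finrank_hom_shift_shift k Z X (-i) 1 (i + 1) (by omega)]
    refine finrank_eq_rank_add_rank _ _ (fun u => by simp [exact₃₁ hT]) fun u hu => ?_
    obtain ⟨v, hv⟩ := lift₃ hT u hu
    exact ⟨v, hv.symm⟩

lemma eulerForm_additive_left (hfin : ∀ X Y : C, {i | homDim k i X Y ≠ 0}.Finite)
    (hT : Triangle.mk f g h ∈ distTriang C) (Z : C) :
    eulerForm k Y Z = eulerForm k X Z + eulerForm k W Z := by
  rw [add_comm]
  refine finsum_alternating_of_exact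
    (r := fun i => Module.finrank k (Linear.leftComp k (Z⟦i⟧) g).range)
    (s := fun i => Module.finrank k (Linear.leftComp k (Z⟦i⟧) f).range)
    (t := fun i => Module.finrank k (Linear.leftComp k (Z⟦i + 1⟧) h).range)
    (fun i => ?_) (fun i => ?_) (fun i => ?_) (hfin _ _) (hfin _ _) (hfin _ _)
  · refine finrank_eq_rank_add_rank (k := k) (V := Y ⟶ Z⟦i⟧) _ _
      (fun u => by simp [reassoc_of% exact₁₂ hT]) fun u hu => ?_
    obtain ⟨v, hv⟩ := desc₂ hT u hu
    exact ⟨v, hv.symm⟩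
  · rw [← finrank_range_leftComp_shift (k := k) (Z⟦i + 1⟧) (Z⟦i⟧) f
      (shiftIso Z _ _ _ (by omega)), ← finrank_hom_shift_shift k X Z 1 (i + 1) i (by omega)]
    refine finrank_eq_rank_add_rank _ _ (fun u => by simp [reassoc_of% exact₃₁ hT]) fun u hu => ?_
    obtain ⟨v, hv⟩ := desc₁ hT u hu
    exact ⟨v, hv.symm⟩
  · refine finrank_eq_rank_add_rank (k := k) (V := W ⟶ Z⟦i + 1⟧) _ _
      (fun u => by simp [reassoc_of% exact₂₃ hT]) fun u hu => ?_
    obtain ⟨v, hv⟩ := desc₃ hT u hu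
    exact ⟨v, hv.symm⟩

/-- Mukai's lemma. -/
lemma mukai (hT : Triangle.mk f g h ∈ distTriang C) (h₀ : ∀ u : X ⟶ W, u = 0)
    (h₂ : ∀ u : W ⟶ X⟦(1 : ℤ)⟧⟦(1 : ℤ)⟧, u = 0) :
    homDim k 1 X X + homDim k 1 W W ≤ homDim k 1 Y Y := by
  -- Restriction `Hom(Y,Y[1]) ⟶ Hom(X,Y[1])`. Its range contains a copy of `Hom(X,X[1])`, because
  -- maps `X ⟶ X[1]` extend to `Y` by `h₂`; its kernel surjects onto a copy of `Hom(W,W[1])`,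
  -- because maps `W ⟶ W[1]` lift to `Y[1]` by `h₂`. The hypothesis `h₀` makes both copies faithful.
  let ρ := Linear.leftComp k (Y⟦(1 : ℤ)⟧) f
  have h₀' : ∀ u : X⟦(1 : ℤ)⟧ ⟶ W⟦(1 : ℤ)⟧, u = 0 := fun u => by
    obtain ⟨u, rfl⟩ := (shiftFunctor C (1 : ℤ)).map_surjective u
    rw [h₀ u, Functor.map_zero]
  have hρ : homDim k 1 Y Y = Module.finrank k ρ.range + Module.finrank k ρ.ker :=
    ρ.finrank_range_add_finrank_ker.symm
  rw [hρ]
  refine add_le_add ?_ ?_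
  · have hinj : Function.Injective (Linear.rightComp k X (f⟦(1 : ℤ)⟧')) := by
      rw [injective_iff_map_eq_zero]
      intro u hu
      obtain ⟨v, rfl⟩ := lift₃ hT u hu
      rw [h₀ v, zero_comp]
    rw [homDim, ← LinearMap.finrank_range_of_inj hinj]
    refine Submodule.finrank_mono ?_
    rintro _ ⟨u, rfl⟩
    obtain ⟨v, hv⟩ : ∃ v : Y⟦(1 : ℤ)⟧ ⟶ X⟦(1 : ℤ)⟧⟦(1 : ℤ)⟧, u⟦(1 : ℤ)⟧' = f⟦(1 : ℤ)⟧' ≫ v :=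
      desc₁ hT _ (h₂ _)
    obtain ⟨v, rfl⟩ := (shiftFunctor C (1 : ℤ)).map_surjective v
    rw [← Functor.map_comp] at hv
    refine ⟨v ≫ f⟦(1 : ℤ)⟧', ?_⟩
    simp [ρ, (shiftFunctor C (1 : ℤ)).map_injective hv]
  · have hinj : Function.Injective (Linear.leftComp k (W⟦(1 : ℤ)⟧) g) := by
      rw [injective_iff_map_eq_zero]
      intro u hu
      obtain ⟨v, rfl⟩ := desc₃ hT u hu
      rw [h₀' v, comp_zero]
    rw [homDim, ← LinearMap.finrank_range_of_inj hinj]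
    let τ := (Linear.rightComp k Y (g⟦(1 : ℤ)⟧')).domRestrict ρ.ker
    refine (Submodule.finrank_mono (t := τ.range) ?_).trans τ.finrank_range_le
    rintro _ ⟨u, rfl⟩
    obtain ⟨v, rfl⟩ := lift_shift₂ hT u (h₂ _)
    refine ⟨⟨g ≫ v, ?_⟩, ?_⟩
    · simp [ρ, reassoc_of% exact₁₂ hT]
    · simp [τ]

end

lemma finrank_hom_eq_zero_of_isZero_left {X : C} (h : IsZero X) (Y : C) :
    Module.finrank k (X ⟶ Y) = 0 := by
  have : Subsingleton (X ⟶ Y) := ⟨fun a b => h.eq_of_src a b⟩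
  exact Module.finrank_zero_of_subsingleton

lemma homDim_eq_zero {i : ℤ} {X Y : C} (h : ∀ u : X ⟶ Y⟦i⟧, u = 0) : homDim k i X Y = 0 := by
  have : Subsingleton (X ⟶ Y⟦i⟧) := ⟨fun a b => (h a).trans (h b).symm⟩
  exact Module.finrank_zero_of_subsingleton

lemma exists_ne_zero_of_finrank_ne_zero {X Y : C} (h : Module.finrank k (X ⟶ Y) ≠ 0) :
    ∃ u : X ⟶ Y, u ≠ 0 := by
  by_contra! hcon
  have : Subsingleton (X ⟶ Y) := ⟨fun a b => (hcon a).trans (hcon b).symm⟩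
  exact h Module.finrank_zero_of_subsingleton

lemma finrank_hom_ne_zero [∀ X Y : C, FiniteDimensional k (X ⟶ Y)] {X Y : C} {u : X ⟶ Y}
    (h : u ≠ 0) : Module.finrank k (X ⟶ Y) ≠ 0 := by
  have : Nontrivial (X ⟶ Y) := ⟨u, 0, h⟩
  exact Module.finrank_pos.ne'

variable (k C) in
lemma IsFiniteType.finiteDimensional_shift (hfin : IsFiniteType k C) (X Y : C) (i : ℤ) :
    FiniteDimensional k (X ⟶ Y⟦i⟧) := by
  have := hfin X Y
  exact Module.Finite.of_surjective (DirectSum.component k ℤ (fun i => (X ⟶ Y⟦i⟧)) i) fun x =>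
    ⟨DirectSum.lof k ℤ (fun i => (X ⟶ Y⟦i⟧)) i x, by simp⟩

variable (k C) in
lemma IsFiniteType.finiteDimensional (hfin : IsFiniteType k C) (X Y : C) :
    FiniteDimensional k (X ⟶ Y) := by
  have := hfin.finiteDimensional_shift k C X Y 0
  exact Module.Finite.equiv (Linear.homCongr k (Iso.refl X) (shiftZeroIso Y))

variable (k C) in
lemma IsFiniteType.finite_support (hfin : IsFiniteType k C) (X Y : C) :
    {i | homDim k i X Y ≠ 0}.Finite := by
  classical
  have := hfin X Y
  obtain ⟨s, hs⟩ := (Module.Finite.fg_top (R := k) (M := DirectSum ℤ fun i => (X ⟶ Y⟦i⟧)))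
  refine (s.biUnion fun x => DFinsupp.support x).finite_toSet.subset fun i hi => ?_
  by_contra hcon
  refine hi (homDim_eq_zero fun u => ?_)
  have h1 : (⊤ : Submodule k (DirectSum ℤ fun i => (X ⟶ Y⟦i⟧))) ≤
      (DirectSum.component k ℤ (fun i => (X ⟶ Y⟦i⟧)) i).ker := by
    rw [← hs, Submodule.span_le]
    intro x hx
    by_contra hne
    refine hcon (Finset.mem_coe.2 (Finset.mem_biUnion.2 ⟨x, hx, ?_⟩))
    exact DFinsupp.mem_support_iff.2 hne
  have h2 := h1 (x := DirectSum.lof k ℤ (fun i => (X ⟶ Y⟦i⟧)) i u) trivial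
  simpa using h2

end HomDim

/-! ### Formal consequences of Serre duality. -/

section Serre

variable {k : Type w} [Field k] {C : Type u} [Category.{v} C] [Preadditive C] [Linear k C]
  [HasZeroObject C] [HasShift C ℤ]
  [∀ n : ℤ, (shiftFunctor C n).Additive] [∀ n : ℤ, (shiftFunctor C n).Linear k]
  [Pretriangulated C] (S : SerreFunctor k C)

lemma SerreFunctor.eq_zero_of_forall {X Y : C} (h : Y ⟶ S.functor.obj X)
    (hh : ∀ f : X ⟶ Y, S.duality X Y f h = 0) : h = 0 := by
  refine (Module.forall_dual_apply_eq_zero_iff k h).1 fun φ => ?_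
  simpa using hh ((S.duality X Y).symm φ)

lemma SerreFunctor.eq_of_forall {X Y : C} (h h' : Y ⟶ S.functor.obj X)
    (hh : ∀ f : X ⟶ Y, S.duality X Y f h = S.duality X Y f h') : h = h' :=
  sub_eq_zero.1 (S.eq_zero_of_forall _ fun f => by rw [map_sub, hh, sub_self])

/-- By naturality, pairing `S(c)` against `f` equals pairing the identity against `c ≫ f`, which is
additive in `c`; nondegeneracy does the rest. -/
lemma SerreFunctor.map_add {X Y : C} (a b : X ⟶ Y) :
    S.functor.map (a + b) = S.functor.map a + S.functor.map b := by
  refine S.eq_of_forall _ _ fun f => ?_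
  have key : ∀ c : X ⟶ Y, S.duality Y (S.functor.obj X) f (S.functor.map c) =
      S.duality X (S.functor.obj X) (c ≫ f) (𝟙 _) := fun c => by
    rw [S.naturality_left, Category.id_comp]
  rw [_root_.map_add, key, key, key, Preadditive.add_comp, _root_.map_add, LinearMap.add_apply]

lemma SerreFunctor.map_smul {X Y : C} (r : k) (a : X ⟶ Y) :
    S.functor.map (r • a) = r • S.functor.map a := by
  refine S.eq_of_forall _ _ fun f => ?_
  have key : ∀ c : X ⟶ Y, S.duality Y (S.functor.obj X) f (S.functor.map c) =
      S.duality X (S.functor.obj X) (c ≫ f) (𝟙 _) := fun c => by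
    rw [S.naturality_left, Category.id_comp]
  rw [_root_.map_smul, key, key, Linear.smul_comp, _root_.map_smul, LinearMap.smul_apply]

variable [∀ X Y : C, FiniteDimensional k (X ⟶ Y)]

lemma SerreFunctor.finrank_eq (X Y : C) :
    Module.finrank k (X ⟶ Y) = Module.finrank k (Y ⟶ S.functor.obj X) :=
  (S.duality X Y).finrank_eq.trans Subspace.dual_finrank_eq

lemma SerreFunctor.exists_ne_zero {X Y : C} {u : X ⟶ Y} (hu : u ≠ 0) :
    ∃ v : Y ⟶ S.functor.obj X, v ≠ 0 :=
  exists_ne_zero_of_finrank_ne_zero (k := k) (by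
    rw [← S.finrank_eq]; exact finrank_hom_ne_zero hu)

lemma SerreFunctor.exists_ne_zero' {X Y : C} {u : Y ⟶ S.functor.obj X} (hu : u ≠ 0) :
    ∃ v : X ⟶ Y, v ≠ 0 :=
  exists_ne_zero_of_finrank_ne_zero (k := k) (by
    rw [S.finrank_eq]; exact finrank_hom_ne_zero hu)

lemma SerreFunctor.homDim_obj (X Y : C) (i : ℤ) :
    homDim k i (S.functor.obj X) (S.functor.obj Y) = homDim k i X Y := by
  rw [← finrank_hom_shift_shift k (S.functor.obj X) (S.functor.obj Y) (-i) 0 i (by omega),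
    finrank_hom_congr k (Iso.refl _) (shiftZeroIso _), ← S.finrank_eq, homDim, S.finrank_eq X,
    ← finrank_hom_congr k (Iso.refl _) (shiftZeroIso (S.functor.obj X)),
    finrank_hom_shift_shift k Y (S.functor.obj X) i 0 (-i) (by omega), homDim]

end Serre

/-! ### Slicings: extension closures, truncation, and kernels and cokernels in `P(a)`. -/

section Phases

variable {C : Type u} [Category.{v} C] [Preadditive C] [HasZeroObject C] [HasShift C ℤ]
  [∀ n : ℤ, (shiftFunctor C n).Additive] [Pretriangulated C]

lemma triangle_of_isZero₃ {E F : C} (e : E ≅ F) {W : C} (hW : IsZero W) :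
    Triangle.mk e.hom (0 : F ⟶ W) (0 : W ⟶ E⟦(1 : ℤ)⟧) ∈ distTriang C := by
  refine (Triangle.distinguished_iff_of_isZero₃ _ hW).2 ?_
  exact inferInstanceAs (IsIso e.hom)

lemma triangle_of_isZero₁ {E F : C} (e : E ≅ F) {W : C} (hW : IsZero W) :
    Triangle.mk (0 : W ⟶ E) e.hom (0 : F ⟶ W⟦(1 : ℤ)⟧) ∈ distTriang C := by
  refine (Triangle.distinguished_iff_of_isZero₁ _ hW).2 ?_
  exact inferInstanceAs (IsIso e.hom)

lemma triangle_iso₂ {X Y Y' W : C} {f : X ⟶ Y} {g : Y ⟶ W} {h : W ⟶ X⟦(1 : ℤ)⟧}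
    (hT : Triangle.mk f g h ∈ distTriang C) (e : Y ≅ Y') :
    Triangle.mk (f ≫ e.hom) (e.inv ≫ g) h ∈ distTriang C :=
  isomorphic_distinguished _ hT _
    (Triangle.isoMk _ _ (Iso.refl X) e.symm (Iso.refl W)
      (by change (f ≫ e.hom) ≫ e.inv = 𝟙 X ≫ f; simp)
      (by change (e.inv ≫ g) ≫ 𝟙 W = e.inv ≫ g; simp)
      (by change h ≫ (𝟙 X)⟦(1 : ℤ)⟧' = 𝟙 W ≫ h; simp))

section

variable {X Y W : C} {f : X ⟶ Y} {g : Y ⟶ W} {h : W ⟶ X⟦(1 : ℤ)⟧}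

lemma isIso_of_isZero₃ (hT : Triangle.mk f g h ∈ distTriang C) (hW : IsZero W) : IsIso f :=
  (Triangle.isZero₃_iff_isIso₁ _ hT).1 hW

lemma isIso_of_isZero₁ (hT : Triangle.mk f g h ∈ distTriang C) (hX : IsZero X) : IsIso g :=
  (Triangle.isZero₁_iff_isIso₂ _ hT).1 hX

lemma isZero₃_of_isIso (hT : Triangle.mk f g h ∈ distTriang C) (hf : IsIso f) : IsZero W :=
  (Triangle.isZero₃_iff_isIso₁ _ hT).2 hf

end

lemma isZero_of_forall_eq_zero {E : C} (h : ∀ u : E ⟶ E, u = 0) : IsZero E :=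
  (IsZero.iff_id_eq_zero E).2 (h _)

variable (σ : StabilityCondition C)

/-- The extension closure of the semistable objects with phases in `I`. -/
inductive Gen (I : Set ℝ) : C → Prop
  | zero {E : C} : IsZero E → Gen I E
  | of {s : ℝ} {E : C} : s ∈ I → σ.P s E → Gen I E
  | ext {X Y W : C} {f : X ⟶ Y} {g : Y ⟶ W} {h : W ⟶ X⟦(1 : ℤ)⟧} :
      Triangle.mk f g h ∈ distTriang C → Gen I X → Gen I W → Gen I Y

/-- `HN σ I t E`: the object `E` has a Harder-Narasimhan filtration with phases in `I`, all of
them `≥ t`. -/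
inductive HN (I : Set ℝ) : ℝ → C → Prop
  | zero {t : ℝ} {E : C} : IsZero E → HN I t E
  | step {t s s' : ℝ} {A E Q : C} {f : A ⟶ E} {g : E ⟶ Q} {h : Q ⟶ A⟦(1 : ℤ)⟧} :
      Triangle.mk f g h ∈ distTriang C → HN I s' A → s < s' → t ≤ s → s ∈ I → σ.P s Q → HN I t E

variable {σ}

lemma Gen.mono {I J : Set ℝ} (hIJ : I ⊆ J) {E : C} (h : Gen σ I E) : Gen σ J E := by
  induction h with
  | zero h => exact .zero h
  | of hs h => exact .of (hIJ hs) h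
  | ext hT _ _ h₁ h₂ => exact .ext hT h₁ h₂

lemma Gen.iso {I : Set ℝ} {E F : C} (h : Gen σ I E) (e : E ≅ F) : Gen σ I F :=
  .ext (triangle_of_isZero₃ e (isZero_zero C)) h (.zero (isZero_zero C))

lemma P_iso {s : ℝ} {E F : C} (h : σ.P s E) (e : E ≅ F) : σ.P s F :=
  (σ.closedUnderIso s).of_iso e h

lemma P_shift_iff (n : ℤ) (s : ℝ) (E : C) : σ.P (s + n) (E⟦n⟧) ↔ σ.P s E := by
  have key : ∀ n : ℤ, σ.P (s + (n + 1 : ℤ)) (E⟦n + 1⟧) ↔ σ.P (s + n) (E⟦n⟧) := fun n => by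
    rw [← σ.shift_iff (s + n), Int.cast_add, Int.cast_one, add_assoc]
    exact ⟨fun h => P_iso h (shiftIso E n 1 (n + 1) rfl),
      fun h => P_iso h (shiftIso E n 1 (n + 1) rfl).symm⟩
  induction n using Int.induction_on with
  | zero =>
    rw [Int.cast_zero, add_zero]
    exact ⟨fun h => P_iso h (shiftZeroIso E), fun h => P_iso h (shiftZeroIso E).symm⟩
  | succ n ih => exact (key _).trans ih
  | pred n ih =>
    have := key (-n - 1)
    rw [sub_add_cancel] at this
    exact this.symm.trans ih

lemma P_shift {s s' : ℝ} {E : C} (h : σ.P s E) (n : ℤ) (hs : s + n = s') : σ.P s' (E⟦n⟧) := by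
  subst hs
  exact (P_shift_iff n s E).2 h

lemma Gen.shift {I J : Set ℝ} (n : ℤ) (hIJ : ∀ i ∈ I, i + n ∈ J) {E : C} (h : Gen σ I E) :
    Gen σ J (E⟦n⟧) := by
  induction h with
  | zero h => exact .zero ((shiftFunctor C n).map_isZero h)
  | of hs h => exact .of (hIJ _ hs) ((P_shift_iff n _ _).2 h)
  | ext hT _ _ h₁ h₂ => exact .ext (Triangle.shift_distinguished _ hT n) h₁ h₂

lemma Gen.third {I : Set ℝ} {X Y W : C} {f : X ⟶ Y} {g : Y ⟶ W} {h : W ⟶ X⟦(1 : ℤ)⟧}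
    (hT : Triangle.mk f g h ∈ distTriang C) (h₂ : Gen σ I Y) (h₁ : Gen σ I (X⟦(1 : ℤ)⟧)) :
    Gen σ I W :=
  .ext (rotate_mem hT) h₂ h₁

lemma Gen.first {I : Set ℝ} {X Y W : C} {f : X ⟶ Y} {g : Y ⟶ W} {h : W ⟶ X⟦(1 : ℤ)⟧}
    (hT : Triangle.mk f g h ∈ distTriang C) (h₂ : Gen σ I Y) (h₃ : Gen σ I (W⟦(-1 : ℤ)⟧)) :
    Gen σ I X :=
  .ext (inv_rot_of_distTriang _ hT) h₃ h₂

lemma Gen.hom_eq_zero_of_forall {I J : Set ℝ}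
    (hIJ : ∀ i ∈ I, ∀ j ∈ J, ∀ A B : C, σ.P i A → σ.P j B → ∀ u : A ⟶ B, u = 0) {E F : C}
    (hE : Gen σ I E) (hF : Gen σ J F) : ∀ u : E ⟶ F, u = 0 := by
  have key : ∀ i ∈ I, ∀ A, σ.P i A → ∀ u : A ⟶ F, u = 0 := by
    intro i hi A hA
    induction hF with
    | zero h => exact fun u => h.eq_of_tgt _ _
    | of hs h => exact hIJ _ hi _ hs _ _ hA h
    | ext hT _ _ h₁ h₂ =>
      intro u
      obtain ⟨v, rfl⟩ := lift₁ hT u (h₂ _)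
      rw [h₁ v, zero_comp]
  induction hE with
  | zero h => exact fun u => h.eq_of_src _ _
  | of hs h => exact key _ hs _ h
  | ext hT _ _ h₁ h₂ =>
    intro u
    obtain ⟨v, rfl⟩ := desc₂ hT u (h₁ _)
    rw [h₂ v, comp_zero]

lemma Gen.hom_eq_zero {I J : Set ℝ} (hIJ : ∀ i ∈ I, ∀ j ∈ J, j < i) {E F : C}
    (hE : Gen σ I E) (hF : Gen σ J F) (u : E ⟶ F) : u = 0 :=
  hE.hom_eq_zero_of_forall (fun i hi j hj A B hA hB => σ.hom_eq_zero i j A B (hIJ i hi j hj) hA hB)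
    hF u

lemma HN.mono {I : Set ℝ} {t t' : ℝ} (htt' : t' ≤ t) {E : C} (h : HN σ I t E) : HN σ I t' E := by
  cases h with
  | zero h => exact .zero h
  | step hT hA hs ht hI hQ => exact .step hT hA hs (htt'.trans ht) hI hQ

lemma HN.iso {I : Set ℝ} {t : ℝ} {E F : C} (h : HN σ I t E) (e : E ≅ F) : HN σ I t F := by
  cases h with
  | zero h => exact .zero (h.of_iso e.symm)
  | step hT hA hs ht hI hQ => exact .step (triangle_iso₂ hT e) hA hs ht hI hQ

lemma HN.gen {I : Set ℝ} {t : ℝ} {E : C} (h : HN σ I t E) : Gen σ (I ∩ Set.Ici t) E := by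
  induction h with
  | zero h => exact .zero h
  | step hT hA hs ht hI hQ ih =>
    exact .ext hT (ih.mono (Set.inter_subset_inter_right _
      (Set.Ici_subset_Ici.2 (ht.trans hs.le)))) (.of ⟨hI, ht⟩ hQ)

variable (σ) in
lemma exists_HN (E : C) : ∃ t, HN σ Set.univ t E := by
  obtain ⟨F⟩ := σ.exists_hn E
  have key : ∀ j : Fin (F.n + 1), ∀ t, (∀ i : Fin F.n, i.castSucc < j → t ≤ F.phase i) →
      HN σ Set.univ t (F.obj j) := by
    intro j
    induction j using Fin.induction with
    | zero => exact fun t _ => .zero F.isZero_obj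
    | succ i ih =>
      intro t ht
      obtain ⟨s', hs', hs''⟩ : ∃ s', F.phase i < s' ∧ ∀ i', i' < i → s' ≤ F.phase i' := by
        rcases Nat.eq_zero_or_pos i.val with h0 | h0
        · exact ⟨F.phase i + 1, by linarith, fun i' hi' => absurd hi' (by
            rw [Fin.lt_def]; omega)⟩
        · refine ⟨F.phase ⟨i - 1, by omega⟩, F.phase_strictAnti (by rw [Fin.lt_def]; simp; omega),
            fun i' hi' => F.phase_strictAnti.antitone ?_⟩
          rw [Fin.lt_def] at hi'
          rw [Fin.le_def]
          simp
          omega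
      refine .step (F.distinguished i) (ih s' fun i' hi' => hs'' i' ?_) hs' (ht i ?_) trivial
        (F.semistable i)
      · simpa using hi'
      · exact Fin.castSucc_lt_succ
  obtain ⟨t, ht⟩ := (Set.finite_range F.phase).bddBelow
  exact ⟨t, (key (Fin.last _) t fun i _ => ht ⟨i, rfl⟩).iso F.isoLast⟩

lemma isZero_third_of_eq_zero {s s' : ℝ} {A E Q : C} {f : A ⟶ E} {g : E ⟶ Q}
    {h : Q ⟶ A⟦(1 : ℤ)⟧} (hT : Triangle.mk f g h ∈ distTriang C) (hA : Gen σ (Set.Ici s') A)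
    (hs : s < s') (hQ : σ.P s Q) (hg : g = 0) : IsZero Q := by
  rw [IsZero.iff_id_eq_zero]
  obtain ⟨v, hv⟩ := desc₃ hT (𝟙 Q) (by rw [hg, zero_comp])
  rw [hv, Gen.hom_eq_zero (σ := σ) (I := Set.Ici (s' + 1)) (J := {s}) ?_
    (hA.shift 1 fun i hi => ?_) (.of rfl hQ) v, comp_zero]
  · intro i hi j hj
    simp only [Set.mem_Ici, Set.mem_singleton_iff] at hi hj
    linarith
  · simp only [Set.mem_Ici, Int.cast_one] at hi ⊢
    linarith

/-- Peel off the factor `Q` of lowest phase `s`. If `s ∉ J`, then `E ⟶ Q` vanishes, which forces `Q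
= 0`. If `s ∈ J` but `s ∉ L`, all phases of `E` exceed those in `L`, so `E = 0`. Otherwise `A`
inherits both memberships. -/
lemma HN.restrict {J L : Set ℝ} (hJ : IsUpperSet J) (hL : IsLowerSet L) {t : ℝ} {E : C}
    (h : HN σ Set.univ t E) (hEJ : Gen σ J E) (hEL : Gen σ L E) : HN σ (J ∩ L) t E := by
  induction h with
  | zero h => exact .zero h
  | @step t s s' A E Q f g h hT hA hs ht _ hQ ih =>
    have hA' : Gen σ (Set.Ici s') A := hA.gen.mono Set.inter_subset_right
    by_cases hsJ : s ∈ J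
    · by_cases hsL : s ∈ L
      · refine .step hT (ih (hA'.mono fun i hi => hJ (hs.le.trans hi) hsJ)
          (Gen.first hT hEL ?_)) hs ht ⟨hsJ, hsL⟩ hQ
        refine .of (hL ?_ hsL) (P_shift hQ (-1) rfl)
        simp
      · refine .zero (isZero_of_forall_eq_zero (Gen.hom_eq_zero (I := Set.Ici s)
          (fun i hi j hj => ?_) (.ext hT (hA'.mono (Set.Ici_subset_Ici.2 hs.le))
          (.of Set.self_mem_Ici hQ)) hEL))
        by_contra! hij
        exact hsL (hL (hi.trans hij) hj)
    · have hg : g = 0 := Gen.hom_eq_zero (J := {s}) (fun i hi j hj => by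
        obtain rfl : j = s := hj
        by_contra! hij
        exact hsJ (hJ hij hi)) hEJ (.of rfl hQ) g
      have := isIso_of_isZero₃ hT (isZero_third_of_eq_zero hT hA' hs hQ hg)
      exact ((ih (hEJ.iso (asIso f).symm) (hEL.iso (asIso f).symm)).mono
        (ht.trans hs.le)).iso (asIso f)

lemma Gen.inter {J L : Set ℝ} (hJ : IsUpperSet J) (hL : IsLowerSet L) {E : C}
    (hEJ : Gen σ J E) (hEL : Gen σ L E) : ∃ t, HN σ (J ∩ L) t E := by
  obtain ⟨t, ht⟩ := exists_HN σ E
  exact ⟨t, ht.restrict hJ hL hEJ hEL⟩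

lemma HN.P_of_subset {I : Set ℝ} {a t : ℝ} (hI : ∀ s ∈ I, s ≤ a) {A E Q : C} {f : A ⟶ E}
    {g : E ⟶ Q} {h : Q ⟶ A⟦(1 : ℤ)⟧} (hT : Triangle.mk f g h ∈ distTriang C) (hA : HN σ I t A)
    (ht : a < t) (hQ : σ.P a Q) : σ.P a E := by
  cases hA with
  | zero hA =>
    have := isIso_of_isZero₁ hT hA
    exact P_iso hQ (asIso g).symm
  | step _ _ _ h₁ h₂ _ => exact absurd (ht.trans_le h₁) (not_lt.2 (hI _ h₂))

lemma P_of_gen {a : ℝ} {E : C} (h₁ : Gen σ (Set.Ici a) E) (h₂ : Gen σ (Set.Iic a) E) :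
    σ.P a E := by
  obtain ⟨t, ht⟩ := h₁.inter (isUpperSet_Ici a) (isLowerSet_Iic a) h₂
  cases ht with
  | zero h => exact σ.zero_mem _ _ h
  | step hT hA hs ht hI hQ =>
    obtain rfl := le_antisymm (Set.mem_Ici.1 hI.1) (Set.mem_Iic.1 hI.2)
    exact hA.P_of_subset (fun _ h => h.2) hT hs hQ

/-- The slicing axioms only provide closure under direct sums; uniqueness of the possible phases
gives closure under extensions. -/
lemma P_ext {a : ℝ} {X Y W : C} {f : X ⟶ Y} {g : Y ⟶ W} {h : W ⟶ X⟦(1 : ℤ)⟧}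
    (hT : Triangle.mk f g h ∈ distTriang C) (hX : σ.P a X) (hW : σ.P a W) : σ.P a Y :=
  P_of_gen (.ext hT (.of Set.self_mem_Ici hX) (.of Set.self_mem_Ici hW))
    (.ext hT (.of Set.self_mem_Iic hX) (.of Set.self_mem_Iic hW))

lemma isZero_of_P_of_P {a b : ℝ} (hab : a ≠ b) {E : C} (ha : σ.P a E) (hb : σ.P b E) :
    IsZero E := by
  rcases hab.lt_or_gt with h | h
  · exact isZero_of_forall_eq_zero (σ.hom_eq_zero _ _ _ _ h hb ha)
  · exact isZero_of_forall_eq_zero (σ.hom_eq_zero _ _ _ _ h ha hb)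

variable (σ) in
/-- Truncation with respect to the phase. -/
lemma exists_truncation [IsTriangulated C] (E : C) (t : ℝ) :
    ∃ (A B : C) (f : A ⟶ E) (g : E ⟶ B) (h : B ⟶ A⟦(1 : ℤ)⟧),
      Triangle.mk f g h ∈ distTriang C ∧ Gen σ (Set.Ioi t) A ∧ Gen σ (Set.Iic t) B := by
  obtain ⟨t₀, hE⟩ := exists_HN σ E
  induction hE with
  | zero h => exact ⟨_, _, _, _, _, triangle_of_isZero₃ (Iso.refl _) h, .zero h, .zero h⟩
  | @step t₀ s s' A E Q f g h hT hA hs _ _ hQ ih =>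
    rcases lt_or_ge t s with hst | hst
    · refine ⟨_, _, _, _, _, triangle_of_isZero₃ (Iso.refl _) (isZero_zero C),
        .ext hT (hA.gen.mono ?_) (.of hst hQ), .zero (isZero_zero C)⟩
      exact fun i hi => (hst.trans hs).trans_le hi.2
    · obtain ⟨A', A'', f', g', h', hT', hA', hA''⟩ := ih
      obtain ⟨B, g₁, h₁, hB⟩ := distinguished_cocone_triangle (f' ≫ f)
      exact ⟨A', B, _, g₁, h₁, hB, hA',
        .ext (Triangulated.someOctahedron rfl hT' hT hB).mem hA'' (.of hst hQ)⟩

section Charge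

lemma Z_add {X Y W : C} {f : X ⟶ Y} {g : Y ⟶ W} {h : W ⟶ X⟦(1 : ℤ)⟧}
    (hT : Triangle.mk f g h ∈ distTriang C) :
    σ.Z (K0.of Y) = σ.Z (K0.of X) + σ.Z (K0.of W) := by
  rw [← map_add]
  congr 1
  refine (QuotientAddGroup.eq_iff_sub_mem
    (x := FreeAbelianGroup.of Y) (y := FreeAbelianGroup.of X + FreeAbelianGroup.of W)).2 ?_
  exact AddSubgroup.subset_closure ⟨_, hT, rfl⟩

lemma Z_of_isZero {E : C} (h : IsZero E) : σ.Z (K0.of E) = 0 := by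
  simpa using Z_add (σ := σ) (triangle_of_isZero₃ (Iso.refl E) h)

variable (σ) in
/-- The height of the central charge of `E` over the ray of phase `a`. -/
noncomputable def height (a : ℝ) (E : C) : ℝ :=
  (σ.Z (K0.of E) * Complex.exp (-(Complex.I * Real.pi * a))).im

lemma height_add (a : ℝ) {X Y W : C} {f : X ⟶ Y} {g : Y ⟶ W} {h : W ⟶ X⟦(1 : ℤ)⟧}
    (hT : Triangle.mk f g h ∈ distTriang C) :
    height σ a Y = height σ a X + height σ a W := by
  rw [height, Z_add hT, add_mul, Complex.add_im, height, height]

lemma height_of_isZero (a : ℝ) {E : C} (h : IsZero E) : height σ a E = 0 := by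
  simp [height, Z_of_isZero h]

lemma exists_height_eq (a : ℝ) {s : ℝ} {E : C} (hE : σ.P s E) (h : ¬ IsZero E) :
    ∃ m : ℝ, 0 < m ∧ height σ a E = m * Real.sin (Real.pi * (s - a)) := by
  obtain ⟨m, hm, hZ⟩ := σ.charge s E hE h
  refine ⟨m, hm, ?_⟩
  rw [height, hZ, mul_assoc, ← Complex.exp_add, Complex.im_ofReal_mul,
    show Complex.I * Real.pi * s + -(Complex.I * Real.pi * a) =
      ((Real.pi * (s - a) : ℝ) : ℂ) * Complex.I by push_cast; ring, Complex.exp_ofReal_mul_I_im]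

lemma height_eq_zero {a : ℝ} {E : C} (hE : σ.P a E) : height σ a E = 0 := by
  by_cases h : IsZero E
  · exact height_of_isZero a h
  · obtain ⟨m, -, hm⟩ := exists_height_eq a hE h
    simp [hm]

lemma height_nonpos {a : ℝ} {E : C} (hE : Gen σ (Set.Ioc (a - 1) a) E) : height σ a E ≤ 0 := by
  induction hE with
  | zero h => rw [height_of_isZero a h]
  | @of s E hs hE =>
    by_cases h : IsZero E
    · rw [height_of_isZero a h]
    · obtain ⟨m, hm, hm'⟩ := exists_height_eq a hE h
      rw [hm']
      refine mul_nonpos_of_nonneg_of_nonpos hm.le (Real.sin_nonpos_of_nonpos_of_neg_pi_le ?_ ?_)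
      · nlinarith [Real.pi_pos, hs.2]
      · nlinarith [Real.pi_pos, hs.1]
  | ext hT _ _ h₁ h₂ => rw [height_add a hT]; linarith

/-- Every factor with phase in `(a - 1, a)` has strictly negative height and none has positive
height, so zero height leaves only phase `a`. -/
lemma P_of_height_eq_zero {I : Set ℝ} {a t : ℝ} (hI : I ⊆ Set.Ioc (a - 1) a) {E : C}
    (hE : HN σ I t E) (h : height σ a E = 0) : σ.P a E := by
  induction hE with
  | zero h0 => exact σ.zero_mem _ _ h0
  | @step t s s' A E Q f g _ hT hA hs ht hsI hQ ih =>
    have hA' : height σ a A ≤ 0 := height_nonpos (hA.gen.mono (Set.inter_subset_left.trans hI))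
    have hQ' : height σ a Q ≤ 0 := height_nonpos (.of (hI hsI) hQ)
    rw [height_add a hT] at h
    by_cases hQ0 : IsZero Q
    · have := isIso_of_isZero₃ hT hQ0
      exact P_iso (ih (by linarith)) (asIso f)
    · obtain ⟨m, hm, hm'⟩ := exists_height_eq a hQ hQ0
      rcases (hI hsI).2.lt_or_eq with hsa | rfl
      · have : Real.sin (Real.pi * (s - a)) < 0 := by
          refine Real.sin_neg_of_neg_of_neg_pi_lt ?_ ?_
          · nlinarith [Real.pi_pos]
          · nlinarith [Real.pi_pos, (hI hsI).1]
        nlinarith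
      · exact hA.P_of_subset (fun s' hs' => (hI hs').2) hT hs hQ

end Charge

/-- Kernels, images and cokernels of morphisms between semistable objects of the same phase. -/
lemma exists_image [IsTriangulated C] {a : ℝ} {E F : C} (hE : σ.P a E) (hF : σ.P a F)
    (f : E ⟶ F) :
    ∃ (K I Q : C) (j : K ⟶ E) (e : E ⟶ I) (i : I ⟶ F) (q : F ⟶ Q) (h₁ : I ⟶ K⟦(1 : ℤ)⟧)
      (h₂ : Q ⟶ I⟦(1 : ℤ)⟧), Triangle.mk j e h₁ ∈ distTriang C ∧
      Triangle.mk i q h₂ ∈ distTriang C ∧ σ.P a K ∧ σ.P a I ∧ σ.P a Q ∧ e ≫ i = f := by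
  obtain ⟨D, g, h, hD⟩ := distinguished_cocone_triangle f
  -- The cone `D` has phases in `[a, a + 1]`; its part of phase `a` is the cokernel, and the part
  -- above `a`, shifted by `-1`, is the kernel.
  obtain ⟨A, Q, f', g', h', hT, hA, hQ⟩ := exists_truncation σ D a
  have hDa : Gen σ (Set.Ici a) D :=
    Gen.third hD (.of Set.self_mem_Ici hF) (.of (by simp) (P_shift hE 1 rfl))
  have hQ : σ.P a Q := P_of_gen (Gen.third hT hDa (hA.shift 1 fun i hi => by
    simp only [Set.mem_Ioi, Set.mem_Ici, Int.cast_one] at hi ⊢; linarith)) hQ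
  obtain ⟨I, i, δ, hI⟩ := distinguished_cocone_triangle₁ (g ≫ g')
  let o := Triangulated.someOctahedron' rfl hD hT hI
  have hPI : σ.P a I := P_of_gen
    (.ext o.mem (.of Set.self_mem_Ici hE) (hA.mono Set.Ioi_subset_Ici_self))
    (Gen.first hI (.of Set.self_mem_Iic hF) (.of (by simp) (P_shift hQ (-1) rfl)))
  have hK := inv_rot_of_distTriang _ o.mem
  -- A priori the kernel only has phases in `(a - 1, a]`. Its height is zero by additivity, so the
  -- central charge pins the phase.
  have hPK : σ.P a (A⟦(-1 : ℤ)⟧) := by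
    have h₁ : Gen σ (Set.Iic a) (A⟦(-1 : ℤ)⟧) :=
      Gen.first hK (.of Set.self_mem_Iic hE) (.of (by simp) (P_shift hPI (-1) rfl))
    have h₂ : Gen σ (Set.Ioi (a - 1)) (A⟦(-1 : ℤ)⟧) := hA.shift (-1) fun i hi => by
      simp only [Set.mem_Ioi, Int.cast_neg, Int.cast_one] at hi ⊢; linarith
    obtain ⟨t, ht⟩ := h₂.inter (isUpperSet_Ioi _) (isLowerSet_Iic _) h₁
    refine P_of_height_eq_zero (fun s hs => ⟨hs.1, hs.2⟩) ht ?_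
    have : height σ a E = height σ a (A⟦(-1 : ℤ)⟧) + height σ a I := height_add a hK
    rw [height_eq_zero hE, height_eq_zero hPI] at this
    linarith
  exact ⟨_, I, Q, _, o.m₁, i, g ≫ g', _, δ, hK, hI, hPK, hPI, hQ, o.comm₁⟩

end Phases

/-! ### Stable objects, and stability of objects with small `hom^1`. -/

section Stable

open scoped ZeroObject

variable {C : Type u} [Category.{v} C] [Preadditive C] [HasZeroObject C] [HasShift C ℤ]
  [∀ n : ℤ, (shiftFunctor C n).Additive] [Pretriangulated C] {σ : StabilityCondition C}

variable (σ) in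
/-- Morphisms between semistable objects raise the phase by less than `6/5`. -/
def PhaseBound : Prop :=
  ∀ (a b : ℝ) (A B : C), σ.P a A → σ.P b B → a + 6 / 5 ≤ b → ∀ u : A ⟶ B, u = 0

lemma phaseBound_of_gldim_lt (h : gldim σ < ((6 / 5 : ℝ) : EReal)) : PhaseBound σ := by
  intro a b A B hA hB hab u
  by_contra hu
  have h1 : ((b - a : ℝ) : EReal) ≤ gldim σ := le_sSup ⟨a, b, A, B, u, hA, hB, hu, rfl⟩
  have h2 := EReal.coe_lt_coe_iff.1 (h1.trans_lt h)
  linarith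

lemma PhaseBound.gen_hom_eq_zero (hσ : PhaseBound σ) {I J : Set ℝ}
    (hIJ : ∀ i ∈ I, ∀ j ∈ J, i + 6 / 5 ≤ j) {E F : C} (hE : Gen σ I E) (hF : Gen σ J F)
    (u : E ⟶ F) : u = 0 :=
  hE.hom_eq_zero_of_forall
    (fun i hi j hj A B hA hB => hσ i j A B hA hB (hIJ i hi j hj)) hF u

lemma PhaseBound.hom_shift_eq_zero (hσ : PhaseBound σ) {a b : ℝ} {E F : C} (hE : σ.P a E)
    (hF : σ.P b F) (i : ℤ) (h : b + i < a ∨ a + 6 / 5 ≤ b + i) (u : E ⟶ F⟦i⟧) : u = 0 := by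
  have hF' : σ.P (b + i) (F⟦i⟧) := P_shift hF i rfl
  rcases h with h | h
  · exact σ.hom_eq_zero _ _ _ _ h hE hF' u
  · exact hσ _ _ _ _ hE hF' h u

lemma PhaseBound.hom_shift_eq_zero_of_same (hσ : PhaseBound σ) {a : ℝ} {E F : C}
    (hE : σ.P a E) (hF : σ.P a F) (i : ℤ) (h₀ : i ≠ 0) (h₁ : i ≠ 1) (u : E ⟶ F⟦i⟧) : u = 0 := by
  refine hσ.hom_shift_eq_zero hE hF i ?_ u
  rcases lt_or_gt_of_ne h₀ with h | h
  · left
    have : (i : ℝ) < 0 := by exact_mod_cast h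
    linarith
  · right
    have : (2 : ℝ) ≤ i := by exact_mod_cast (by omega : (2 : ℤ) ≤ i)
    linarith

variable (σ) in
/-- A stable object of phase `a`, i.e. a simple object of `P(a)`. -/
structure Stable (a : ℝ) (A : C) : Prop where
  mem : σ.P a A
  not_isZero : ¬ IsZero A
  isIso_of_strict : ∀ (B W : C) (f : B ⟶ A) (g : A ⟶ W) (h : W ⟶ B⟦(1 : ℤ)⟧),
    Triangle.mk f g h ∈ distTriang C → σ.P a B → σ.P a W → ¬ IsZero B → IsIso f

lemma Stable.iso {a : ℝ} {A A' : C} (hA : Stable σ a A) (e : A ≅ A') : Stable σ a A' where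
  mem := P_iso hA.mem e
  not_isZero h := hA.not_isZero (h.of_iso e)
  isIso_of_strict B W f g h hT hB hW hB0 := by
    have := hA.isIso_of_strict B W _ _ _ (triangle_iso₂ hT e.symm) hB hW hB0
    exact IsIso.of_isIso_comp_right f e.symm.hom

/-- Such an `f` is a monomorphism of `P(a)`: the obstruction is a map from `A` to `W[-1]`, which has
smaller phase. -/
lemma eq_zero_of_comp_eq_zero {a : ℝ} {X Y W A : C} {f : X ⟶ Y} {g : Y ⟶ W}
    {h : W ⟶ X⟦(1 : ℤ)⟧} (hT : Triangle.mk f g h ∈ distTriang C) (hW : σ.P a W) (hA : σ.P a A)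
    (u : A ⟶ X) (hu : u ≫ f = 0) : u = 0 := by
  obtain ⟨v, rfl⟩ := Triangle.coyoneda_exact₂ _ (inv_rot_of_distTriang _ hT) u hu
  have hv : v = 0 := σ.hom_eq_zero a (a + (-1 : ℤ)) _ _ (by simp) hA (P_shift hW (-1) rfl) v
  rw [hv]
  exact zero_comp

lemma ne_zero_of_third {a : ℝ} {X Y W : C} {f : X ⟶ Y} {g : Y ⟶ W}
    {h : W ⟶ X⟦(1 : ℤ)⟧} (hT : Triangle.mk f g h ∈ distTriang C) (hX : σ.P a X) (hW : σ.P a W)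
    (hW0 : ¬ IsZero W) : g ≠ 0 := by
  intro hg
  obtain ⟨v, hv⟩ := desc₃ hT (𝟙 W) (by rw [hg, zero_comp])
  have hv0 : v = 0 := σ.hom_eq_zero (a + (1 : ℤ)) a _ _ (by simp) (P_shift hX 1 rfl) hW v
  exact hW0 ((IsZero.iff_id_eq_zero W).2 (by rw [hv, hv0, comp_zero]))

variable [IsTriangulated C]

lemma Stable.exists_isIso_image {a : ℝ} {A F : C} (hA : Stable σ a A) (hF : σ.P a F) {f : A ⟶ F}
    (hf : f ≠ 0) : ∃ (I Q : C) (e : A ⟶ I) (i : I ⟶ F) (q : F ⟶ Q) (h : Q ⟶ I⟦(1 : ℤ)⟧),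
      Triangle.mk i q h ∈ distTriang C ∧ IsIso e ∧ σ.P a I ∧ σ.P a Q ∧ e ≫ i = f := by
  obtain ⟨K, I, Q, j, e, i, q, h₁, h₂, hT₁, hT₂, hK, hI, hQ, rfl⟩ := exists_image hA.mem hF f
  refine ⟨I, Q, e, i, q, h₂, hT₂, ?_, hI, hQ, rfl⟩
  by_cases hK0 : IsZero K
  · exact isIso_of_isZero₁ hT₁ hK0
  · have := hA.isIso_of_strict _ _ _ _ _ hT₁ hK hI hK0
    exact absurd (by rw [(isZero₃_of_isIso hT₁ this).eq_of_src i 0, comp_zero]) hf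

lemma Stable.exists_triangle {a : ℝ} {A F : C} (hA : Stable σ a A) (hF : σ.P a F) {f : A ⟶ F}
    (hf : f ≠ 0) : ∃ (Q : C) (q : F ⟶ Q) (h : Q ⟶ A⟦(1 : ℤ)⟧),
      Triangle.mk f q h ∈ distTriang C ∧ σ.P a Q := by
  obtain ⟨I, Q, e, i, q, h, hT, he, -, hQ, hei⟩ := hA.exists_isIso_image hF hf
  obtain ⟨D, q', h', hD⟩ := distinguished_cocone_triangle f
  have hZ := triangle_of_isZero₃ (asIso e) (isZero_zero C)
  exact ⟨D, q', h', hD, P_ext (Triangulated.someOctahedron hei hZ hT hD).mem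
    (σ.zero_mem a _ (isZero_zero C)) hQ⟩

lemma Stable.isIso_of_ne_zero {a : ℝ} {A B : C} (hA : Stable σ a A) (hB : Stable σ a B)
    {f : A ⟶ B} (hf : f ≠ 0) : IsIso f := by
  obtain ⟨Q, q, h, hT, hQ⟩ := hA.exists_triangle hB.mem hf
  exact hB.isIso_of_strict _ _ _ _ _ hT hA.mem hQ hA.not_isZero

lemma Stable.finrank_end (k : Type w) [Field k] [IsAlgClosed k] [Linear k C]
    [∀ X Y : C, FiniteDimensional k (X ⟶ Y)] {a : ℝ} {A : C} (hA : Stable σ a A) :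
    Module.finrank k (A ⟶ A) = 1 := by
  refine finrank_endomorphism_eq_one k fun f => ⟨fun hf h0 => ?_, hA.isIso_of_ne_zero hA⟩
  subst h0
  exact hA.not_isZero (isZero_of_forall_eq_zero fun u => by
    have := IsIso.inv_hom_id (0 : A ⟶ A)
    rw [comp_zero] at this
    rw [← Category.comp_id u, ← this, comp_zero])

lemma phaseIn_of_P {a : ℝ} {I : Set ℝ} (ha : a ∈ I) {E : C} (hE : σ.P a E) :
    phaseIn σ.P I E := by
  have hz : ∀ i : Fin 1, IsZero (Fin.cases (motive := fun _ => C) 0 (fun _ => E) i.castSucc) := fun i => by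
    rw [Subsingleton.elim i 0]
    exact isZero_zero C
  exact ⟨{
    n := 1
    phase := fun _ => a
    phase_strictAnti := Subsingleton.strictAnti _
    obj := fun j => Fin.cases (motive := fun _ => C) 0 (fun _ => E) j
    factor := fun _ => E
    isZero_obj := isZero_zero C
    isoLast := Iso.refl E
    ι := fun _ => 0
    π := fun _ => 𝟙 E
    δ := fun _ => 0
    distinguished := fun i => triangle_of_isZero₁ (Iso.refl E) (hz i)
    semistable := fun _ => hE }, fun _ => ha⟩

variable (σ) in
lemma exists_isFiniteLength (a : ℝ) : ∃ I : Set ℝ, a ∈ I ∧ IsFiniteLength (phaseIn σ.P I) := by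
  obtain ⟨η, hη, -, h⟩ := σ.locallyFinite
  exact ⟨Set.Ioo (a - η) (a + η), ⟨by linarith, by linarith⟩, h a⟩

lemma isStrictMono_of_P {a : ℝ} {I : Set ℝ} (ha : a ∈ I) {X Y W : C} {f : X ⟶ Y} {g : Y ⟶ W}
    {h : W ⟶ X⟦(1 : ℤ)⟧} (hT : Triangle.mk f g h ∈ distTriang C) (hX : σ.P a X) (hY : σ.P a Y)
    (hW : σ.P a W) : IsStrictMono (phaseIn σ.P I) f :=
  ⟨phaseIn_of_P ha hX, phaseIn_of_P ha hY, W, g, h, phaseIn_of_P ha hW, hT⟩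

/-- Otherwise every nonzero subobject of `E` in `P(a)` has a proper nonzero one, giving an infinite
descending chain against local finiteness. -/
lemma exists_stable {a : ℝ} {E : C} (hE : σ.P a E) (hE0 : ¬ IsZero E) :
    ∃ (A : C) (f : A ⟶ E), Stable σ a A ∧ f ≠ 0 := by
  by_contra! hcon
  let T := {B : C // σ.P a B ∧ ¬ IsZero B ∧ ∀ (A : C) (f : A ⟶ B), Stable σ a A → f = 0}
  have step : ∀ B : T, ∃ (B' : T) (f : B'.1 ⟶ B.1) (W : C) (g : B.1 ⟶ W)
      (h : W ⟶ B'.1⟦(1 : ℤ)⟧), Triangle.mk f g h ∈ distTriang C ∧ σ.P a W ∧ ¬ IsIso f := by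
    rintro ⟨B, hB, hB0, hBA⟩
    have hns : ¬ Stable σ a B := fun hs =>
      hB0 ((IsZero.iff_id_eq_zero B).2 (hBA B (𝟙 B) hs))
    by_contra! hno
    refine hns ⟨hB, hB0, fun B' W f g h hT hB' hW hB'0 => ?_⟩
    refine hno ⟨B', hB', hB'0, fun A u hA => ?_⟩ f W g h hT hW
    exact eq_zero_of_comp_eq_zero hT hW hA.mem u (hBA A _ hA)
  choose next f W g h hT hW hf using step
  let X : ℕ → T := fun n => Nat.rec ⟨E, hE, hE0, hcon⟩ (fun _ B => next B) n
  obtain ⟨I, haI, hI⟩ := exists_isFiniteLength σ a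
  obtain ⟨N, hN⟩ := hI.artinian (fun n => (X n).1) (fun n => f (X n)) fun n =>
    isStrictMono_of_P haI (hT (X n)) (X (n + 1)).2.1 (X n).2.1 (hW (X n))
  exact hf _ (hN N le_rfl)

/-- Iterated extensions of `n` copies of `A`. -/
inductive IterExt (A : C) : ℕ → C → Prop
  | zero {E : C} : IsZero E → IterExt A 0 E
  | step {n : ℕ} {E' E : C} {f : E' ⟶ E} {g : E ⟶ A} {h : A ⟶ E'⟦(1 : ℤ)⟧} :
      Triangle.mk f g h ∈ distTriang C → IterExt A n E' → IterExt A (n + 1) E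

lemma IterExt.iso {A : C} {n : ℕ} {E E' : C} (h : IterExt A n E) (e : E ≅ E') :
    IterExt A n E' := by
  cases h with
  | zero h => exact .zero (h.of_iso e.symm)
  | step hT h => exact .step (triangle_iso₂ hT e) h

lemma IterExt.mem {a : ℝ} {A : C} (hA : σ.P a A) {n : ℕ} {E : C} (h : IterExt A n E) :
    σ.P a E := by
  induction h with
  | zero h => exact σ.zero_mem _ _ h
  | step hT _ ih => exact P_ext hT ih hA

lemma IterExt.hom_eq_zero {A R : C} (hA : ∀ u : A ⟶ R, u = 0) {n : ℕ} {E : C}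
    (h : IterExt A n E) : ∀ u : E ⟶ R, u = 0 := by
  induction h with
  | zero h => exact fun u => h.eq_of_src _ _
  | step hT _ ih =>
    intro u
    obtain ⟨v, rfl⟩ := desc₂ hT u (ih _)
    rw [hA v, comp_zero]

/-- The maximal subobject of `E` that is an iterated extension of copies of `A`. -/
lemma Stable.exists_iterExt {a : ℝ} {A E : C} (hA : Stable σ a A) (hE : σ.P a E) :
    ∃ (n : ℕ) (E' R : C) (j : E' ⟶ E) (q : E ⟶ R) (h : R ⟶ E'⟦(1 : ℤ)⟧),
      Triangle.mk j q h ∈ distTriang C ∧ IterExt A n E' ∧ σ.P a R ∧ ∀ u : A ⟶ R, u = 0 := by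
  by_contra! hcon
  let T := {p : Σ E' : C, (E' ⟶ E) // (∃ n, IterExt A n p.1) ∧
    ∃ (R : C) (q : E ⟶ R) (h : R ⟶ p.1⟦(1 : ℤ)⟧), Triangle.mk p.2 q h ∈ distTriang C ∧ σ.P a R}
  have step : ∀ p : T, ∃ (p' : T) (i : p.1.1 ⟶ p'.1.1), i ≫ p'.1.2 = p.1.2 ∧ ¬ IsIso i := by
    rintro ⟨⟨E', j⟩, ⟨n, hn⟩, R, q, h, hT, hR⟩
    -- A nonzero map `A ⟶ R` is a subobject; its preimage in `E` is a strictly larger iterated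
    -- extension, so failure yields an infinite ascending chain.
    obtain ⟨u, hu⟩ := hcon n E' R j q h hT hn hR
    obtain ⟨R', r, h', hT', hR'⟩ := hA.exists_triangle hR hu
    obtain ⟨E'', j', δ, hI⟩ := distinguished_cocone_triangle₁ (q ≫ r)
    let o := Triangulated.someOctahedron' rfl hT hT' hI
    refine ⟨⟨⟨E'', j'⟩, ⟨n + 1, .step o.mem hn⟩, R', _, δ, hI, hR'⟩, o.m₁, o.comm₁, fun hi => ?_⟩
    exact hA.not_isZero (isZero₃_of_isIso o.mem hi)
  choose next i hi hi' using step
  let X : ℕ → T := fun n => Nat.rec ⟨⟨0, 0⟩, ⟨0, .zero (isZero_zero C)⟩, E, 𝟙 E, 0,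
    triangle_of_isZero₁ (Iso.refl E) (isZero_zero C), hE⟩ (fun _ p => next p) n
  obtain ⟨I, haI, hI⟩ := exists_isFiniteLength σ a
  obtain ⟨N, hN⟩ := hI.noetherian E (fun n => (X n).1.1) (fun n => i (X n)) (fun n => (X n).1.2)
    (fun n => by
      obtain ⟨⟨m, hm⟩, R, q, h, hT, hR⟩ := (X n).2
      exact isStrictMono_of_P haI hT (hm.mem hA.mem) hE hR) (fun n => hi (X n))
  exact hi' _ (hN N le_rfl)

variable {k : Type w} [Field k] [IsAlgClosed k] [Linear k C]
  [∀ n : ℤ, (shiftFunctor C n).Linear k] [∀ X Y : C, FiniteDimensional k (X ⟶ Y)]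

lemma IterExt.eulerForm_left (hfin : ∀ X Y : C, {i | homDim k i X Y ≠ 0}.Finite) {A : C} {n : ℕ}
    {E : C} (h : IterExt A n E) (Z : C) : eulerForm k E Z = n * eulerForm k A Z := by
  induction h with
  | zero h =>
    have := eulerForm_additive_left hfin (triangle_of_isZero₃ (Iso.refl A) h) Z
    simpa using this
  | step hT _ ih => rw [eulerForm_additive_left hfin hT, ih]; push_cast; ring

lemma IterExt.eulerForm_right (hfin : ∀ X Y : C, {i | homDim k i X Y ≠ 0}.Finite) {A : C} {n : ℕ}
    {E : C} (h : IterExt A n E) (Z : C) : eulerForm k Z E = n * eulerForm k Z A := by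
  induction h with
  | zero h =>
    have := eulerForm_additive_right hfin (triangle_of_isZero₃ (Iso.refl A) h) Z
    simpa using this
  | step hT _ ih => rw [eulerForm_additive_right hfin hT, ih]; push_cast; ring

variable {d : ℕ}

/-- In the last Harder-Narasimhan triangle, `A[2]` lies more than `2` phases above `Q`. So Mukai's
lemma applies, and nonzero `A` and `Q` would give `hom^1(E,E) ≥ 2d`. -/
lemma PhaseBound.exists_mem_of_homDim_lt (hσ : PhaseBound σ)
    (hd : ∀ E : C, ¬ IsZero E → d ≤ homDim k 1 E E)
    {E : C} (hE0 : ¬ IsZero E) (hE : homDim k 1 E E < 2 * d) : ∃ a, σ.P a E := by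
  obtain ⟨t, ht⟩ := exists_HN σ E
  induction ht with
  | zero h => exact absurd h hE0
  | @step t s s' A E Q f g h hT hA hs _ _ hQ ih =>
    by_cases hQ0 : IsZero Q
    · have := isIso_of_isZero₃ hT hQ0
      obtain ⟨a, ha⟩ := ih (fun h => hE0 (h.of_iso (asIso f).symm))
        (by rwa [homDim_congr k (asIso f) (asIso f)])
      exact ⟨a, P_iso ha (asIso f)⟩
    · by_cases hA0 : IsZero A
      · have := isIso_of_isZero₁ hT hA0
        exact ⟨s, P_iso hQ (asIso g).symm⟩
      · have hA' : Gen σ (Set.Ici s') A := hA.gen.mono Set.inter_subset_right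
        have := mukai (k := k) hT
          (Gen.hom_eq_zero (J := {s}) (fun i hi j hj => by
            obtain rfl : j = s := hj
            exact hs.trans_le hi) hA' (.of rfl hQ))
          (hσ.gen_hom_eq_zero (I := {s}) (J := Set.Ici (s' + 1 + 1)) (fun i hi j hj => by
            obtain rfl : i = s := hi
            simp only [Set.mem_Ici] at hj
            linarith) (.of rfl hQ) ((hA'.shift (J := Set.Ici (s' + 1)) 1 fun i hi => by
              simpa using hi).shift 1 fun i hi => by simpa using hi))
        have h1 := hd _ hA0
        have h2 := hd _ hQ0
        omega

lemma PhaseBound.eulerForm_eq (hσ : PhaseBound σ) {a : ℝ} {E F : C} (hE : σ.P a E)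
    (hF : σ.P a F) : eulerForm k E F = homDim k 0 E F - homDim k 1 E F :=
  StabCurve.eulerForm_eq k fun i h₀ h₁ =>
    homDim_eq_zero (hσ.hom_shift_eq_zero_of_same hE hF i h₀ h₁)

/-- The composite `E ⟶ A ⟶ E` is nonzero because `f` is a monomorphism, hence a nonzero multiple of
the identity; so `f` is an isomorphism. -/
lemma Stable.of_finrank_end_le_one {a : ℝ} {A E E' : C} (hA : Stable σ a A) {f : A ⟶ E}
    (hf : f ≠ 0) {j : E' ⟶ E} {g : E ⟶ A} {h : A ⟶ E'⟦(1 : ℤ)⟧}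
    (hT : Triangle.mk j g h ∈ distTriang C) (hE' : σ.P a E')
    (hE : Module.finrank k (E ⟶ E) ≤ 1) : Stable σ a E := by
  have hPE := P_ext hT hE' hA.mem
  have hg := ne_zero_of_third hT hE' hA.mem hA.not_isZero
  obtain ⟨Q, q, h', hT', hQ⟩ := hA.exists_triangle hPE hf
  have hgf : g ≫ f ≠ 0 := fun h0 => hg (eq_zero_of_comp_eq_zero hT' hQ hPE g h0)
  obtain ⟨c, hc⟩ := finrank_le_one_iff.1 hE
  obtain ⟨x, hx⟩ := hc (g ≫ f)
  obtain ⟨y, hy⟩ := hc (𝟙 E)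
  have hx0 : x ≠ 0 := fun h0 => hgf (by rw [← hx, h0, zero_smul])
  have h1 : ((y * x⁻¹) • g) ≫ f = 𝟙 E := by
    rw [Linear.smul_comp, ← hx, smul_smul, mul_assoc, inv_mul_cancel₀ hx0, mul_one, hy]
  have h2 : f ≫ ((y * x⁻¹) • g) = 𝟙 A := by
    rw [← sub_eq_zero]
    refine eq_zero_of_comp_eq_zero hT' hQ hA.mem _ ?_
    rw [Preadditive.sub_comp, Category.assoc, h1, Category.comp_id, Category.id_comp, sub_self]
  exact hA.iso ⟨f, _, h2, h1⟩

lemma PhaseBound.exists_stable_of_homDim_lt (hσ : PhaseBound σ)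
    (hfin : ∀ X Y : C, {i | homDim k i X Y ≠ 0}.Finite)
    (hd : ∀ E : C, ¬ IsZero E → d ≤ homDim k 1 E E) (hd1 : 1 ≤ d)
    {E : C} (hE0 : ¬ IsZero E) (hE : homDim k 1 E E < 2 * d) : ∃ a, Stable σ a E := by
  obtain ⟨a, ha⟩ := hσ.exists_mem_of_homDim_lt hd hE0 hE
  refine ⟨a, ?_⟩
  obtain ⟨A, f, hA, hf⟩ := exists_stable ha hE0
  obtain ⟨n, E', R, j, q, h, hT, hn, hR, hAR⟩ := hA.exists_iterExt ha
  have hE'P := hn.mem hA.mem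
  have hE'0 : ¬ IsZero E' := fun h0 => by
    have := isIso_of_isZero₁ hT h0
    refine hf ?_
    rw [← cancel_mono q, hAR (f ≫ q), zero_comp]
  -- `Hom(E',R) = 0` by maximality of `E'`, so a nonzero `R` would again contradict Mukai's lemma.
  have hR0 : IsZero R := by
    by_contra hR0
    have := mukai (k := k) hT (hn.hom_eq_zero hAR) (hσ _ _ _ _ hR
      (P_shift (P_shift hE'P 1 rfl) 1 rfl) (by push_cast; linarith))
    have h1 := hd _ hE'0
    have h2 := hd _ hR0
    omega
  have := isIso_of_isZero₃ hT hR0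
  replace hn := hn.iso (asIso j)
  have hn' := hn
  cases hn' with
  | zero h0 => exact absurd h0 hE0
  | @step m E₁ _ f₁ g₁ h₁ hT₁ hn₁ =>
    refine hA.of_finrank_end_le_one (k := k) hf hT₁ (hn₁.mem hA.mem) ?_
    rcases m with _ | m
    · cases hn₁ with
      | zero h0 =>
        have := isIso_of_isZero₁ hT₁ h0
        rw [finrank_hom_congr k (asIso g₁) (asIso g₁), hA.finrank_end k]
    -- For `n = m + 2` copies of `A`, `hom^0(E,E) = hom^1(E,E) + n² (1 - hom^1(A,A)) ≤ (2d - 1) + 4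
    -- (1 - d) = 3 - 2d ≤ 1`. The hint `m (m + 4)` below is `n² - 4`.
    · have h1 : eulerForm k E E = ((m + 1 + 1 : ℕ) : ℤ) * (((m + 1 + 1 : ℕ) : ℤ) *
          eulerForm k A A) := by
        rw [hn.eulerForm_left hfin, hn.eulerForm_right hfin]
      rw [hσ.eulerForm_eq ha ha, hσ.eulerForm_eq hA.mem hA.mem, homDim_zero, homDim_zero,
        hA.finrank_end k] at h1
      have h2 := hd _ hA.not_isZero
      zify at h2 hE hd1 ⊢
      push_cast at h1
      nlinarith [mul_nonneg (mul_nonneg (Nat.cast_nonneg (α := ℤ) m) (by positivity :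
        (0 : ℤ) ≤ m + 4)) (sub_nonneg.2 (hd1.trans h2))]

end Stable

section LinearAlgebra

lemma finrank_le_of_surjective {k U V : Type*} [Field k] [AddCommGroup U] [Module k U]
    [AddCommGroup V] [Module k V] [FiniteDimensional k U] (a : U →ₗ[k] V)
    (ha : ∀ v, ∃ u, a u = v) : Module.finrank k V ≤ Module.finrank k U := by
  rw [← finrank_top k V, ← LinearMap.range_eq_top.2 ha]
  exact a.finrank_range_le

end LinearAlgebra

/-! ### Cones of maps `X ⟶ SX[-1]` and the exclusion of a phase jump. -/

section Cone

variable {C : Type u} [Category.{v} C] [Preadditive C] [HasZeroObject C] [HasShift C ℤ]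
  [∀ n : ℤ, (shiftFunctor C n).Additive] [Pretriangulated C] [IsTriangulated C]
  {σ : StabilityCondition C}
  {k : Type w} [Field k] [IsAlgClosed k] [Linear k C]
  [∀ n : ℤ, (shiftFunctor C n).Linear k] [∀ X Y : C, FiniteDimensional k (X ⟶ Y)] {d : ℕ}

lemma extend_of_forall_eq_zero {X Y W Z : C} {f : X ⟶ Y} {g : Y ⟶ W} {h : W ⟶ X⟦(1 : ℤ)⟧}
    (hT : Triangle.mk f g h ∈ distTriang C) (hW : ∀ w : W ⟶ Z⟦(1 : ℤ)⟧, w = 0) (u : X ⟶ Z) :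
    ∃ v : Y ⟶ Z, f ≫ v = u := by
  obtain ⟨v, hv⟩ := desc₁ hT (u⟦(1 : ℤ)⟧') (hW _)
  obtain ⟨v, rfl⟩ := (shiftFunctor C (1 : ℤ)).map_surjective v
  rw [← Functor.map_comp] at hv
  exact ⟨v, ((shiftFunctor C (1 : ℤ)).map_injective hv).symm⟩

/-- The inequality is strict because `f` itself dies in `Hom(X,G)`. -/
lemma finrank_hom_cone_lt {X Y G : C} {f : X ⟶ Y} {g : Y ⟶ G} {h : G ⟶ X⟦(1 : ℤ)⟧}
    (hT : Triangle.mk f g h ∈ distTriang C) (hf : f ≠ 0) :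
    Module.finrank k (X ⟶ G) < Module.finrank k (X ⟶ Y) + homDim k 1 X X := by
  have h1 := finrank_eq_rank_add_rank (k := k) (Linear.rightComp k X g) (Linear.rightComp k X h)
    (fun u => by simp [exact₂₃ hT]) fun u hu => by
      obtain ⟨v, hv⟩ := lift₂ hT u hu
      exact ⟨v, hv.symm⟩
  have h2 := (Linear.rightComp k X g).finrank_range_add_finrank_ker
  have h3 := (Linear.rightComp k X h).range.finrank_le
  have : Nontrivial (Linear.rightComp k X g).ker :=
    ⟨⟨f, by simp [exact₁₂ hT]⟩, 0, fun h => hf (congrArg Subtype.val h)⟩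
  have h4 := Module.finrank_pos (R := k) (M := (Linear.rightComp k X g).ker)
  rw [homDim]
  omega

/-- The situation of a stable object `X` with `Y = S X[-1]` of strictly larger phase, together
with bounds for the phases of `S Y` and of `S⁻¹ X[2]`. -/
structure SerreShift (σ : StabilityCondition C) (S : SerreFunctor k C) (d : ℕ) (φ ψ : ℝ)
    (X Y : C) where
  phaseBound : PhaseBound σ
  finite_support : ∀ X Y : C, {i | homDim k i X Y ≠ 0}.Finite
  le_homDim : ∀ E : C, ¬ IsZero E → d ≤ homDim k 1 E E
  pos : 1 ≤ d
  stable_X : Stable σ φ X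
  stable_Y : Stable σ ψ Y
  iso : Y⟦(1 : ℤ)⟧ ≅ S.functor.obj X
  lt : φ < ψ
  lt_add : ψ < φ + 1 / 5
  homDim_X : homDim k 1 X X = d
  homDim_Y : homDim k 1 Y Y = d
  phaseSY : ℝ
  mem_SY : σ.P phaseSY (S.functor.obj Y)
  phaseSY_lt : phaseSY < φ + 7 / 5
  preX : C
  isoPre : X⟦(1 : ℤ)⟧⟦(1 : ℤ)⟧ ≅ S.functor.obj preX
  phasePre : ℝ
  mem_preX : σ.P phasePre preX
  lt_phasePre : φ + 4 / 5 < phasePre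

namespace SerreShift

variable {S : SerreFunctor k C} {φ ψ : ℝ} {X Y G : C} (D : SerreShift σ S d φ ψ X Y)
  {f : X ⟶ Y} {g : Y ⟶ G} {h : G ⟶ X⟦(1 : ℤ)⟧}

include D

lemma finrank_hom_Y (E : C) : Module.finrank k (E ⟶ Y⟦(1 : ℤ)⟧) = Module.finrank k (X ⟶ E) :=
  (finrank_hom_congr k (Iso.refl E) D.iso).trans (S.finrank_eq X E).symm

lemma finrank_hom : Module.finrank k (X ⟶ Y) = d := by
  rw [(shiftHomEquiv k 1 X Y).finrank_eq, D.finrank_hom_Y]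
  exact D.homDim_X

lemma finrank_hom_lt (hT : Triangle.mk f g h ∈ distTriang C) (hf : f ≠ 0) :
    Module.finrank k (X ⟶ G) < 2 * d := by
  have := finrank_hom_cone_lt (k := k) hT hf
  rw [D.finrank_hom, D.homDim_X] at this
  omega

lemma mem_shift_X : σ.P (φ + 2) (X⟦(1 : ℤ)⟧⟦(1 : ℤ)⟧) :=
  P_shift (P_shift D.stable_X.mem 1 rfl) 1 (by push_cast; ring)

/-- The phases of the cone of a nonzero map `X ⟶ Y` lie on one side of `φ + 3/5`. -/
lemma isZero_or_isZero (hT : Triangle.mk f g h ∈ distTriang C) (hf : f ≠ 0) {A B : C}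
    {a : A ⟶ G} {b : G ⟶ B} {c : B ⟶ A⟦(1 : ℤ)⟧} (hG : Triangle.mk a b c ∈ distTriang C)
    (hA : Gen σ (Set.Ioi (φ + 3 / 5)) A) (hB : Gen σ (Set.Iic (φ + 3 / 5)) B) :
    IsZero A ∨ IsZero B := by
  -- The cut may lie anywhere in `[φ + 2/5, φ + 4/5]`: the lower end makes `Hom(Y,A[1])` vanish, the
  -- upper end `Hom(B,X[2])`. Then `hom^1(A,A) ≤ hom(X,A)`, `hom^1(B,B) ≤ hom(X,B)`, and these two
  -- add up to `hom(X,G) < 2d`.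
  by_contra! hcon
  have hσ := D.phaseBound
  have hlt := D.lt_add
  have hA1 : Gen σ (Set.Ioi (φ + 8 / 5)) (A⟦(1 : ℤ)⟧) := hA.shift 1 fun i hi => by
    simp only [Set.mem_Ioi, Int.cast_one] at hi ⊢; linarith
  have hA2 : Gen σ (Set.Ioi (φ + 13 / 5)) (A⟦(1 : ℤ)⟧⟦(1 : ℤ)⟧) := hA1.shift 1 fun i hi => by
    simp only [Set.mem_Ioi, Int.cast_one] at hi ⊢; linarith
  have hBA : ∀ u : B ⟶ A⟦(1 : ℤ)⟧⟦(1 : ℤ)⟧, u = 0 := hσ.gen_hom_eq_zero (fun i hi j hj => by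
    simp only [Set.mem_Ioi, Set.mem_Iic] at hi hj; linarith) hB hA2
  have a₁ : homDim k 1 A A ≤ Module.finrank k (G ⟶ A⟦(1 : ℤ)⟧) :=
    finrank_le_of_surjective (Linear.leftComp k _ a) (extend_of_forall_eq_zero hG hBA)
  have a₂ : Module.finrank k (G ⟶ A⟦(1 : ℤ)⟧) ≤ Module.finrank k (X ⟶ A) := by
    rw [(shiftHomEquiv k 1 X A).finrank_eq]
    refine finrank_le_of_surjective (Linear.leftComp k _ h) fun u => ?_
    obtain ⟨v, hv⟩ := desc₃ hT u (hσ.gen_hom_eq_zero (I := {ψ}) (fun i hi j hj => by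
      simp only [Set.mem_Ioi, Set.mem_singleton_iff] at hi hj; linarith)
      (.of rfl D.stable_Y.mem) hA1 _)
    exact ⟨v, hv.symm⟩
  have b₁ : homDim k 1 B B ≤ Module.finrank k (B ⟶ G⟦(1 : ℤ)⟧) := by
    refine finrank_le_of_surjective (Linear.rightComp k _ (b⟦(1 : ℤ)⟧')) fun u => ?_
    obtain ⟨v, hv⟩ := lift_shift₂ hG u (hBA _)
    exact ⟨v, hv.symm⟩
  have b₂ : Module.finrank k (B ⟶ G⟦(1 : ℤ)⟧) ≤ Module.finrank k (X ⟶ B) := by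
    rw [← D.finrank_hom_Y]
    refine finrank_le_of_surjective (Linear.rightComp k _ (g⟦(1 : ℤ)⟧')) fun u => ?_
    obtain ⟨v, hv⟩ := lift_shift₂ hT u (hσ.gen_hom_eq_zero (J := {φ + 2}) (fun i hi j hj => by
      simp only [Set.mem_Iic, Set.mem_singleton_iff] at hi hj; linarith) hB
      (.of rfl D.mem_shift_X) _)
    exact ⟨v, hv.symm⟩
  have hXA : Function.Injective (Linear.rightComp k X a) := by
    rw [injective_iff_map_eq_zero]
    intro u hu
    obtain ⟨v, rfl⟩ := Triangle.coyoneda_exact₂ _ (inv_rot_of_distTriang _ hG) u hu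
    have hv : v = 0 := Gen.hom_eq_zero (σ := σ) (I := {φ}) (J := Set.Iic (φ - 2 / 5))
      (fun i hi j hj => by
        simp only [Set.mem_Iic, Set.mem_singleton_iff] at hi hj; linarith)
      (.of rfl D.stable_X.mem) (hB.shift (-1) fun i hi => by
        simp only [Set.mem_Iic, Int.cast_neg, Int.cast_one] at hi ⊢; linarith) v
    rw [hv]
    exact zero_comp
  have hXB : Function.Surjective (Linear.rightComp k X b) := fun u => by
    obtain ⟨v, hv⟩ := lift₂ hG u (hσ.gen_hom_eq_zero (I := {φ}) (fun i hi j hj => by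
      simp only [Set.mem_Ioi, Set.mem_singleton_iff] at hi hj; linarith)
      (.of rfl D.stable_X.mem) hA1 _)
    exact ⟨v, hv.symm⟩
  have hXG := finrank_eq_rank_add_rank (k := k) (Linear.rightComp k X a) (Linear.rightComp k X b)
    (fun u => by simp [exact₁₂ hG]) fun u hu => by
      obtain ⟨v, hv⟩ := lift₁ hG u hu
      exact ⟨v, hv.symm⟩
  rw [LinearMap.finrank_range_of_inj hXA, LinearMap.range_eq_top.2 hXB, finrank_top] at hXG
  have h₁ := D.finrank_hom_lt hT hf
  have h₂ := D.le_homDim _ hcon.1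
  have h₃ := D.le_homDim _ hcon.2
  omega

/-- A nonzero map `G ⟶ X[2]` forces a large phase in `G`. -/
lemma exists_preX_ne_zero {u : G ⟶ X⟦(1 : ℤ)⟧⟦(1 : ℤ)⟧} (hu : u ≠ 0) :
    ∃ v : D.preX ⟶ G, v ≠ 0 := by
  refine S.exists_ne_zero' (u := u ≫ D.isoPre.hom) fun h0 => hu ?_
  rw [← cancel_mono D.isoPre.hom, h0, zero_comp]

lemma not_isZero_cone (hT : Triangle.mk f g h ∈ distTriang C) : ¬ IsZero G := fun h0 => by
  have := isIso_of_isZero₃ hT h0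
  exact D.stable_X.not_isZero
    (isZero_of_P_of_P D.lt.ne D.stable_X.mem (P_iso D.stable_Y.mem (asIso f).symm))

lemma hom_Y_eq_zero (u : Y ⟶ X⟦(1 : ℤ)⟧⟦(1 : ℤ)⟧) : u = 0 :=
  D.phaseBound _ _ _ _ D.stable_Y.mem D.mem_shift_X (by linarith [D.lt_add]) u

/-- If `Hom(G,X[2]) = 0` or `Hom(Y,G[1]) = 0`, then `hom^1(G,G) ≤ hom(X,G) < 2d`. If neither
vanishes, Serre duality gives nonzero maps `preX ⟶ G` and `G[1] ⟶ SY`, so `G` has both a phase above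
`φ + 4/5` and one below `φ + 2/5`, against `isZero_or_isZero`. -/
lemma homDim_cone_lt (hT : Triangle.mk f g h ∈ distTriang C) (hf : f ≠ 0) :
    homDim k 1 G G < 2 * d := by
  by_cases h₁ : ∀ a : X ⟶ X⟦(1 : ℤ)⟧, ∃ u : Y ⟶ X⟦(1 : ℤ)⟧, f ≫ u = a
  · have hz : ∀ v : G ⟶ X⟦(1 : ℤ)⟧⟦(1 : ℤ)⟧, v = 0 := fun v => by
      obtain ⟨v, rfl⟩ := desc₃ hT v (D.hom_Y_eq_zero _)
      obtain ⟨a, rfl⟩ := (shiftFunctor C (1 : ℤ)).map_surjective v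
      obtain ⟨u, rfl⟩ := h₁ a
      rw [Functor.map_comp, reassoc_of% exact₃₁ hT, zero_comp]
    refine lt_of_le_of_lt ?_ (D.finrank_hom_lt hT hf)
    rw [← D.finrank_hom_Y]
    refine finrank_le_of_surjective (Linear.rightComp k _ (g⟦(1 : ℤ)⟧')) fun u => ?_
    obtain ⟨v, hv⟩ := lift_shift₂ hT u (hz _)
    exact ⟨v, hv.symm⟩
  by_cases h₂ : ∀ b : Y ⟶ Y⟦(1 : ℤ)⟧, ∃ u : Y ⟶ X⟦(1 : ℤ)⟧, u ≫ f⟦(1 : ℤ)⟧' = b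
  · have hz : ∀ v : Y ⟶ G⟦(1 : ℤ)⟧, v = 0 := fun v => by
      obtain ⟨v, rfl⟩ := lift_shift₂ hT v (D.hom_Y_eq_zero _)
      obtain ⟨u, rfl⟩ := h₂ v
      rw [Category.assoc, ← Functor.map_comp, exact₁₂ hT, Functor.map_zero, comp_zero]
    refine lt_of_le_of_lt ?_ (D.finrank_hom_lt hT hf)
    rw [(shiftHomEquiv k 1 X G).finrank_eq]
    refine finrank_le_of_surjective (Linear.leftComp k _ h) fun u => ?_
    obtain ⟨v, hv⟩ := desc₃ hT u (hz _)
    exact ⟨v, hv.symm⟩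
  exfalso
  push Not at h₁ h₂
  obtain ⟨x, hx⟩ := h₁
  obtain ⟨y, hy⟩ := h₂
  obtain ⟨u, hu⟩ : ∃ u : D.preX ⟶ G, u ≠ 0 := by
    refine D.exists_preX_ne_zero (u := h ≫ x⟦(1 : ℤ)⟧') fun h0 => ?_
    obtain ⟨v, hv⟩ := desc₁ hT _ h0
    obtain ⟨v, rfl⟩ := (shiftFunctor C (1 : ℤ)).map_surjective v
    rw [← Functor.map_comp] at hv
    exact hx v ((shiftFunctor C (1 : ℤ)).map_injective hv).symm
  obtain ⟨w, hw⟩ : ∃ w : G⟦(1 : ℤ)⟧ ⟶ S.functor.obj Y, w ≠ 0 := by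
    refine S.exists_ne_zero (u := y ≫ g⟦(1 : ℤ)⟧') fun h0 => ?_
    obtain ⟨v, hv⟩ := lift_shift₁ hT _ h0
    exact hy v hv.symm
  obtain ⟨A, B, a, b, c, hG, hA, hB⟩ := exists_truncation σ G (φ + 3 / 5)
  rcases D.isZero_or_isZero hT hf hG hA hB with h0 | h0
  · have := isIso_of_isZero₁ hG h0
    refine hu (Gen.hom_eq_zero (I := {D.phasePre}) (fun i hi j hj => ?_) (.of rfl D.mem_preX)
      (hB.iso (asIso b).symm) u)
    have := D.lt_phasePre
    simp only [Set.mem_Iic, Set.mem_singleton_iff] at hi hj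
    linarith
  · have := isIso_of_isZero₃ hG h0
    refine hw (Gen.hom_eq_zero (I := Set.Ioi (φ + 8 / 5)) (J := {D.phaseSY})
      (fun i hi j hj => ?_) ((hA.iso (asIso a)).shift 1 fun i hi => ?_) (.of rfl D.mem_SY) w)
    · have := D.phaseSY_lt
      simp only [Set.mem_Ioi, Set.mem_singleton_iff] at hi hj
      linarith
    · simp only [Set.mem_Ioi, Int.cast_one] at hi ⊢
      linarith

lemma exists_stable_cone (hT : Triangle.mk f g h ∈ distTriang C) (hf : f ≠ 0) :
    ∃ γ, ψ ≤ γ ∧ γ ≤ φ + 1 ∧ Stable σ γ G := by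
  obtain ⟨γ, hγ⟩ := D.phaseBound.exists_stable_of_homDim_lt (k := k) D.finite_support D.le_homDim
    D.pos (D.not_isZero_cone hT) (D.homDim_cone_lt hT hf)
  have hG : Gen σ (Set.Icc ψ (φ + 1)) G := Gen.third hT
    (.of ⟨le_rfl, by linarith [D.lt_add]⟩ D.stable_Y.mem)
    (.of ⟨by linarith [D.lt_add], le_rfl⟩ (P_shift D.stable_X.mem 1 (by simp)))
  refine ⟨γ, ?_, ?_, hγ⟩
  · by_contra! hlt
    refine hγ.not_isZero (isZero_of_forall_eq_zero (Gen.hom_eq_zero (J := {γ})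
      (fun i hi j hj => ?_) hG (.of rfl hγ.mem)))
    obtain rfl : j = γ := hj
    exact hlt.trans_le hi.1
  · by_contra! hlt
    refine hγ.not_isZero (isZero_of_forall_eq_zero (Gen.hom_eq_zero (I := {γ})
      (fun i hi j hj => ?_) (.of rfl hγ.mem) hG))
    obtain rfl : i = γ := hi
    exact hj.2.trans_lt hlt

/-- Expanding `χ(G,G)` bilinearly with `χ(X,X) = χ(Y,Y) = 1 - d`, `χ(X,Y) = d - 1` and `χ(Y,X) =
-hom^1(Y,X)` gives `3 - 3d + hom^1(Y,X)`. Since `G` is stable, this is `1 - hom^1(G,G) ≤ 1 - d`. -/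
lemma finrank_le (hT : Triangle.mk f g h ∈ distTriang C) (hf : f ≠ 0) :
    homDim k 1 Y X + 2 ≤ 2 * d := by
  obtain ⟨γ, -, -, hγ⟩ := D.exists_stable_cone hT hf
  have hσ := D.phaseBound
  have hfin := D.finite_support
  have hlt := D.lt
  have hlt' := D.lt_add
  have e₁ := eulerForm_additive_left (k := k) hfin hT G
  have e₂ := eulerForm_additive_right (k := k) hfin hT X
  have e₃ := eulerForm_additive_right (k := k) hfin hT Y
  have hX := hσ.eulerForm_eq (k := k) D.stable_X.mem D.stable_X.mem
  have hY := hσ.eulerForm_eq (k := k) D.stable_Y.mem D.stable_Y.mem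
  have hG := hσ.eulerForm_eq (k := k) hγ.mem hγ.mem
  have hXY : eulerForm k X Y = homDim k 0 X Y - homDim k 1 X Y := by
    refine eulerForm_eq k fun i h₀ h₁ => homDim_eq_zero
      (hσ.hom_shift_eq_zero D.stable_X.mem D.stable_Y.mem i ?_)
    rcases lt_or_gt_of_ne h₀ with hi | hi
    · left
      have : (i : ℝ) ≤ -1 := by exact_mod_cast (by omega : i ≤ -1)
      linarith
    · right
      have : (2 : ℝ) ≤ i := by exact_mod_cast (by omega : (2 : ℤ) ≤ i)
      linarith
  have hYX : eulerForm k Y X = homDim k 0 Y X - homDim k 1 Y X := by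
    refine eulerForm_eq k fun i h₀ h₁ => homDim_eq_zero
      (hσ.hom_shift_eq_zero D.stable_Y.mem D.stable_X.mem i ?_)
    rcases lt_or_gt_of_ne h₀ with hi | hi
    · left
      have : (i : ℝ) ≤ -1 := by exact_mod_cast (by omega : i ≤ -1)
      linarith
    · right
      have : (2 : ℝ) ≤ i := by exact_mod_cast (by omega : (2 : ℤ) ≤ i)
      linarith
  have hYX0 : homDim k 0 Y X = 0 :=
    homDim_eq_zero (hσ.hom_shift_eq_zero D.stable_Y.mem D.stable_X.mem 0 (by simp [hlt]))
  have hXY1 : homDim k 1 X Y = 1 := (D.finrank_hom_Y X).trans (D.stable_X.finrank_end k)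
  have hd := D.le_homDim _ hγ.not_isZero
  rw [D.homDim_X, homDim_zero, D.stable_X.finrank_end k] at hX
  rw [D.homDim_Y, homDim_zero, D.stable_Y.finrank_end k] at hY
  rw [homDim_zero, hγ.finrank_end k] at hG
  rw [homDim_zero, D.finrank_hom, hXY1] at hXY
  rw [hYX0] at hYX
  omega

lemma elim : False := by
  obtain ⟨m, rfl⟩ : ∃ m, d = m + 1 := ⟨d - 1, by have := D.pos; omega⟩
  have : S.functor.IsEquivalence := S.isEquivalence
  obtain ⟨f₀, hf₀⟩ : ∃ f₀ : X ⟶ Y, f₀ ≠ 0 :=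
    exists_ne_zero_of_finrank_ne_zero (k := k) (by rw [D.finrank_hom]; omega)
  obtain ⟨G₀, g₀, h₀, hT₀⟩ := distinguished_cocone_triangle f₀
  have hle := D.finrank_le hT₀ hf₀
  let B : (X ⟶ Y) →ₗ[k] (X ⟶ Y) →ₗ[k] (X⟦(1 : ℤ)⟧ ⟶ S.functor.obj Y) :=
    LinearMap.mk₂ k (fun f₁ f₂ => (f₁⟦(1 : ℤ)⟧' ≫ D.iso.hom) ≫ S.functor.map f₂)
      (fun f₁ f₁' f₂ => by simp [Functor.map_add])
      (fun c f₁ f₂ => by simp [Functor.map_smul])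
      (fun f₁ f₂ f₂' => by rw [S.map_add, Preadditive.comp_add])
      (fun c f₁ f₂ => by rw [S.map_smul, Linear.comp_smul])
  obtain ⟨f₁, f₂, hf₁, hf₂, hB⟩ := exists_ne_zero_bilin_eq_zero (m := m) B D.finrank_hom
    D.finrank_hom (by
      rw [← S.finrank_eq]
      change homDim k 1 Y X ≤ _
      omega)
  replace hB : (f₁⟦(1 : ℤ)⟧' ≫ D.iso.hom) ≫ S.functor.map f₂ = 0 := hB
  have hS0 : S.functor.map (0 : X ⟶ Y) = 0 := by
    have h := S.map_smul (0 : k) (0 : X ⟶ Y)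
    rwa [zero_smul, zero_smul] at h
  obtain ⟨G₁, g₁, h₁, hT₁⟩ := distinguished_cocone_triangle f₁
  obtain ⟨G₂, g₂, h₂, hT₂⟩ := distinguished_cocone_triangle f₂
  obtain ⟨γ₁, hψ₁, hφ₁, hγ₁⟩ := D.exists_stable_cone hT₁ hf₁
  obtain ⟨γ₂, hψ₂, hφ₂, hγ₂⟩ := D.exists_stable_cone hT₂ hf₂
  -- `S(f₂)` kills `f₁[1]`, hence factors through a nonzero map `G₁[1] ⟶ SY`.
  have hlt₁ : γ₁ < φ + 2 / 5 := by
    have hm : D.iso.hom ≫ S.functor.map f₂ ≠ 0 := fun h0 => hf₂ (S.functor.map_injective (by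
      rw [hS0, ← cancel_epi D.iso.hom, h0, comp_zero]))
    obtain ⟨v, hv⟩ := desc_shift₂ hT₁ (D.iso.hom ≫ S.functor.map f₂)
      (by rw [← Category.assoc, hB])
    have hv0 : v ≠ 0 := fun h0 => hm (by rw [hv, h0, comp_zero])
    by_contra! hge
    exact hv0 (σ.hom_eq_zero (γ₁ + 1) D.phaseSY _ _ (by linarith [D.phaseSY_lt])
      (P_shift hγ₁.mem 1 (by simp)) D.mem_SY v)
  have hlt₂ : φ + 4 / 5 < γ₂ := by
    obtain ⟨u, hu⟩ : ∃ u : G₂ ⟶ X⟦(1 : ℤ)⟧⟦(1 : ℤ)⟧, u ≠ 0 := by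
      by_contra! hcon
      -- If `Hom(G₂,X[2]) = 0`, every `a : X ⟶ X[1]` factors through `f₂`; pairing it with `f₁[1]`
      -- then produces the zero product, so `f₁ = 0` by nondegeneracy.
      have hℓ : f₁⟦(1 : ℤ)⟧' ≫ D.iso.hom = 0 := by
        refine S.eq_zero_of_forall _ fun a => ?_
        obtain ⟨v, hv⟩ := desc₁ hT₂ (a⟦(1 : ℤ)⟧') (hcon _)
        obtain ⟨v, rfl⟩ := (shiftFunctor C (1 : ℤ)).map_surjective v
        rw [← Functor.map_comp] at hv
        rw [(shiftFunctor C (1 : ℤ)).map_injective hv, S.naturality_left, hB, map_zero]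
      refine hf₁ ((shiftFunctor C (1 : ℤ)).map_injective ?_)
      rw [← cancel_mono D.iso.hom, hℓ, Functor.map_zero, zero_comp]
    obtain ⟨v, hv⟩ := D.exists_preX_ne_zero hu
    by_contra! hge
    exact hv (σ.hom_eq_zero _ _ _ _ (by linarith [D.lt_phasePre]) D.mem_preX hγ₂.mem v)
  -- The central charges of `G₁` and `G₂` agree, so both heights over phase `γ₁` vanish; but `0 < γ₂
  -- - γ₁ < 1` makes that of `G₂` positive.
  have e₁ := height_add (σ := σ) γ₁ hT₁
  have e₂ := height_add (σ := σ) γ₁ hT₂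
  have e₃ := height_eq_zero hγ₁.mem
  obtain ⟨c, hc, e₄⟩ := exists_height_eq γ₁ hγ₂.mem hγ₂.not_isZero
  have hsin : 0 < Real.sin (Real.pi * (γ₂ - γ₁)) := by
    have := D.lt
    refine Real.sin_pos_of_pos_of_lt_pi (mul_pos Real.pi_pos (by linarith)) ?_
    nlinarith [Real.pi_pos]
  have := mul_pos hc hsin
  linarith

end SerreShift

end Cone

/-! ### Minimal objects satisfy `S F ≅ F[1]`. -/

section Main

variable {C : Type u} [Category.{v} C] [Preadditive C] [HasZeroObject C] [HasShift C ℤ]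
  [∀ n : ℤ, (shiftFunctor C n).Additive] [Pretriangulated C] [IsTriangulated C]
  {σ : StabilityCondition C}
  {k : Type w} [Field k] [IsAlgClosed k] [Linear k C]
  [∀ n : ℤ, (shiftFunctor C n).Linear k] [∀ X Y : C, FiniteDimensional k (X ⟶ Y)] {d : ℕ}

/-- An object `F` with minimal `hom^1(F, F)` satisfies `S F ≅ F[1]`. -/
lemma PhaseBound.exists_stable_and_serre (hσ : PhaseBound σ) (S : SerreFunctor k C)
    (hfin : ∀ X Y : C, {i | homDim k i X Y ≠ 0}.Finite)
    (hd : ∀ E : C, ¬ IsZero E → d ≤ homDim k 1 E E) (hd1 : 1 ≤ d) {F : C}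
    (hF : homDim k 1 F F = d) :
    ∃ φ, Stable σ φ F ∧ Nonempty (S.functor.obj F ≅ F⟦(1 : ℤ)⟧) := by
  have : S.functor.IsEquivalence := S.isEquivalence
  -- The functor `S` and the shift preserve `hom^1(E,E)`, so `F`, `SF[-1]`, `S(SF[-1])` and
  -- `S⁻¹F[2]` are all stable. The bounds on their phases come from the nonzero maps `E ⟶ SE` dual
  -- to identities.
  have small : ∀ E : C, homDim k 1 E E = d → ∃ a, Stable σ a E := fun E hE =>
    hσ.exists_stable_of_homDim_lt hfin hd hd1 (fun h0 => by
      rw [homDim, finrank_hom_eq_zero_of_isZero_left h0] at hE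
      omega) (by omega)
  let Y : C := (S.functor.obj F)⟦(-1 : ℤ)⟧
  let θ : Y⟦(1 : ℤ)⟧ ≅ S.functor.obj F :=
    (shiftIso _ (-1) 1 0 (by simp)).symm ≪≫ shiftZeroIso _
  have hY : homDim k 1 Y Y = d := by
    rw [homDim_shift_shift k _ _ (-1) (-1) 1 1 rfl, S.homDim_obj, hF]
  let X₀ : C := S.functor.objPreimage (F⟦(1 : ℤ)⟧⟦(1 : ℤ)⟧)
  let e₀ : S.functor.obj X₀ ≅ F⟦(1 : ℤ)⟧⟦(1 : ℤ)⟧ := S.functor.objObjPreimageIso _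
  have hX₀ : homDim k 1 X₀ X₀ = d := by
    rw [← S.homDim_obj, homDim_congr k e₀ e₀, homDim_shift_shift k _ _ 1 1 1 1 rfl,
      homDim_shift_shift k _ _ 1 1 1 1 rfl, hF]
  obtain ⟨φ, hφ⟩ := small F hF
  obtain ⟨ψ, hψ⟩ := small Y hY
  obtain ⟨χ, hχ⟩ := small (S.functor.obj Y) (by rw [S.homDim_obj, hY])
  obtain ⟨ω, hω⟩ := small X₀ hX₀
  have id_ne_zero : ∀ {a : ℝ} {E : C}, Stable σ a E → 𝟙 E ≠ 0 := fun hE h0 =>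
    hE.not_isZero ((IsZero.iff_id_eq_zero _).2 h0)
  have hSF : σ.P (ψ + 1) (S.functor.obj F) := P_iso (P_shift hψ.mem 1 (by simp)) θ
  obtain ⟨f, hf⟩ : ∃ f : F ⟶ Y, f ≠ 0 := exists_ne_zero_of_finrank_ne_zero (k := k) (by
    rw [(shiftHomEquiv k 1 F Y).finrank_eq, finrank_hom_congr k (Iso.refl _) θ, ← S.finrank_eq]
    change homDim k 1 F F ≠ 0
    omega)
  have h₁ : φ ≤ ψ := by
    by_contra! hlt
    exact hf (σ.hom_eq_zero _ _ _ _ hlt hφ.mem hψ.mem f)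
  have h₂ : ψ < φ + 1 / 5 := by
    obtain ⟨u, hu⟩ := S.exists_ne_zero (id_ne_zero hφ)
    by_contra! hge
    exact hu (hσ _ _ _ _ hφ.mem hSF (by linarith) u)
  have h₃ : χ < ψ + 6 / 5 := by
    obtain ⟨u, hu⟩ := S.exists_ne_zero (id_ne_zero hψ)
    by_contra! hge
    exact hu (hσ _ _ _ _ hψ.mem hχ.mem hge u)
  have h₄ : φ + 4 / 5 < ω := by
    obtain ⟨u, hu⟩ := S.exists_ne_zero (id_ne_zero hω)
    by_contra! hge
    exact hu (hσ _ _ _ _ hω.mem (P_iso (P_shift (P_shift hφ.mem 1 rfl) 1 rfl) e₀.symm)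
      (by push_cast; linarith) u)
  refine ⟨φ, hφ, ?_⟩
  rcases h₁.eq_or_lt with rfl | hlt
  · have := hφ.isIso_of_ne_zero hψ hf
    exact ⟨θ.symm ≪≫ (shiftFunctor C (1 : ℤ)).mapIso (asIso f).symm⟩
  · exact (SerreShift.elim (σ := σ) (S := S) (d := d) (φ := φ) (ψ := ψ) (X := F) (Y := Y)
      { phaseBound := hσ, finite_support := hfin, le_homDim := hd, pos := hd1, stable_X := hφ,
        stable_Y := hψ, iso := θ, lt := hlt, lt_add := h₂, homDim_X := hF, homDim_Y := hY,
        phaseSY := χ, mem_SY := hχ.mem, phaseSY_lt := by linarith, preX := X₀, isoPre := e₀.symm,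
        phasePre := ω, mem_preX := hω.mem, lt_phasePre := h₄ }).elim

end Main

end StabCurve

theorem proposition3p1
    (k : Type w) [Field k] [IsAlgClosed k] [CharZero k]
    (C : Type u) [Category.{v} C] [Preadditive C] [Linear k C] [HasZeroObject C] [HasShift C ℤ]
    [∀ n : ℤ, (shiftFunctor C n).Additive] [∀ n : ℤ, (shiftFunctor C n).Linear k]
    [Pretriangulated C] [IsTriangulated C]
    (hfin : IsFiniteType k C)
    (S : SerreFunctor k C)
    (d : ℕ)
    (hd : IsLeast {m : ℕ | ∃ E : C, ¬ IsZero E ∧ m = homDim k 1 E E} d)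
    (hd_pos : 1 ≤ d)
    (hgldim : (⨅ σ : StabilityCondition C, gldim σ) < ((6 / 5 : ℝ) : EReal)) :
    d = 1 ∧ ∀ F : C, homDim k 1 F F = 1 → IsOneSpherical S F := by
  obtain ⟨σ, hσ⟩ := iInf_lt_iff.1 hgldim
  replace hσ := phaseBound_of_gldim_lt hσ
  have := hfin.finiteDimensional k C
  have main : ∀ F : C, homDim k 1 F F = d →
      ∃ φ, Stable σ φ F ∧ Nonempty (S.functor.obj F ≅ F⟦(1 : ℤ)⟧) := fun F hF =>
    hσ.exists_stable_and_serre S (hfin.finite_support k C) (fun E hE => hd.2 ⟨E, hE, rfl⟩) hd_pos hF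
  -- `hom^1(E,E) = hom(E,SE) = hom(E,E) = 1` by Serre duality and Schur's lemma.
  have hd1 : d = 1 := by
    obtain ⟨E, -, hE⟩ := hd.1
    obtain ⟨φ, hφ, ⟨e⟩⟩ := main E hE.symm
    rw [hE, homDim, finrank_hom_congr k (Iso.refl E) e.symm, ← S.finrank_eq, hφ.finrank_end k]
  subst hd1
  refine ⟨rfl, fun F hF => ?_⟩
  obtain ⟨φ, hφ, hS⟩ := main F hF
  exact
    { serre := hS
      hom_zero := by rw [homDim_zero, hφ.finrank_end k]
      hom_one := hF
      hom_other := fun i h₀ h₁ => subsingleton_of_forall_eq 0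
        (hσ.hom_shift_eq_zero_of_same hφ.mem hφ.mem i h₀ h₁) }
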